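/- For $F\in\mathbb{Z}[T]$ let $H(F)$ be the maximum modulus of its coefficients. Call $F$ reducible if it has a factor $G\in\mathbb{Z}[T]$ with $0<\deg G<\deg F$, and irreducible otherwise (constant factors are disregarded). Let $\tau(a)$ be the number of positive divisors of the integer $a\neq 0$. For an integer $n\ge 2$ and $H>1$ let $\mathcal{A}_n(H)$ be the set of pairs $(P,Q)$ of integer polynomials without non-constant common factor such that $\deg P=n$, $P(0)=0$, $\deg Q<n$ and $\max\{H(P),H(Q)\}\le H$. Write $c_n$ for the leading coefficient of $P$ and $d_0=Q(0)$ (so $d_0\ne 0$), and put $$S_\ell=\ell P+Q,\qquad R_\ell=P+\ell Q,\qquad M_{\ell_1,\ell_2}=\ell_1P+\ell_2Q,$$ $$\Gamma=\tau(c_n)\tau(d_0)\log H,\qquad \Gamma'=\tau(c_n)\tau(d_0)\frac{\log H}{\log\log H}.$$ All estimates below are as $H\to\infty$: $A\ll_u B$ means $A\le cB$ for all sufficiently large $H$ and all admissible $(P,Q)\in\mathcal{A}_n(H)$, with $c>0$ depending only on $u$ (absolute if no $u$ is given), while "sufficiently large" depends only on the parameters among $n,\epsilon,\delta$ that occur;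 and $A\ll H^{o(1)}$ means that for every $\eta>0$ one has $A\le H^{\eta}$ for all sufficiently large $H$ (depending also on $\eta$), uniformly in $(P,Q)$. **Theorem 1.7.** Let $n\ge2$ be an integer. For every $\epsilon>0$ there is an effectively computable $\delta_0=\delta_0(n,\epsilon)>0$ such that the following hold for all $(P,Q)\in\mathcal{A}_n(H)$. (i) Let $n\in\{2,3\}$. There are only $\ll\Gamma'\ll H^{o(1)}$ many primes $\ell$ (of either sign) for which $S_\ell$ is reducible; in particular only finitely many. For every $\delta>0$ there are $\gg_\delta H^{\delta}/\log H$ many primes $0<\ell\le H^\delta$ for which $S_\ell$ is irreducible, and the smallest such prime satisfies $\ell\ll H^{o(1)}$. The same claims hold for $R_\ell$. (ii) Let $n\ge4$ and suppose that $P$ has a complex root $\alpha$ and $Q$ a complex root $\beta$ with $|\alpha-\beta|\le H^{-(2n-6)-\epsilon}$. Then there are only $\ll_n\Gamma\ll H^{o(1)}$ many primes $0<\ell\le H^{\delta_0}$ for which $S_\ell$ is reducible. For every $0<\delta\le\delta_0$ there are $\gg H^\delta/\log H$ many primes $0<\ell\le H^\delta$ for which $S_\ell$ is irreducible, and the smallest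 such prime satisfies $\ell\ll H^{o(1)}$. The same claims hold for $R_\ell$. (iii) Let $n\ge2$ and suppose that $P$ has a complex root $\alpha$ and $Q$ a complex root $\beta$ with $|\alpha-\beta|\le H^{-\theta_n-\epsilon}$, where $\theta_2=1$ and $\theta_n=2n-4$ for $n\ge3$. Then the number of pairs of coprime integers $1\le\ell_1<\ell_2\le H^{\delta_0}$ for which $M_{\ell_1,\ell_2}$ is reducible is $\ll_n\Gamma\ll H^{o(1)}$. For every $0<\delta\le\delta_0$ there are $\gg H^{2\delta}$ many integer pairs $1\le\ell_1<\ell_2\le H^\delta$ for which $M_{\ell_1,\ell_2}$ is irreducible. -/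

import Mathlib

open Polynomial

/-- The naive height of an integer polynomial: the maximum modulus of its coefficients. -/
def naiveHeight (P : ℤ[X]) : ℕ := P.support.sup fun i => (P.coeff i).natAbs

/-- A polynomial is reducible if it has a non-constant factor of smaller degree
(constant factors are disregarded). -/
def IsReduciblePoly (F : ℤ[X]) : Prop :=
  ∃ G : ℤ[X], G ∣ F ∧ 0 < G.natDegree ∧ G.natDegree < F.natDegree

/-- No non-constant common factor. -/
def NoCommonFactor (P Q : ℤ[X]) : Prop :=
  ∀ G : ℤ[X], G ∣ P → G ∣ Q → G.natDegree = 0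

/-- The standing assumptions on the pair `P, Q`, the degree `n` and the height bound `H`. -/
structure AdmissiblePair (n : ℕ) (H : ℝ) (P Q : ℤ[X]) : Prop where
  natDegree_left : P.natDegree = n
  coeff_zero_left : P.coeff 0 = 0
  natDegree_right : Q.natDegree < n
  noCommonFactor : NoCommonFactor P Q
  height_left : (naiveHeight P : ℝ) ≤ H
  height_right : (naiveHeight Q : ℝ) ≤ H

/-- `P` has a complex root `α` and `Q` has a complex root `β` with `|α - β| ≤ r`. -/
def HaveCloseRoots (P Q : ℤ[X]) (r : ℝ) : Prop :=
  ∃ α β : ℂ, aeval α P = 0 ∧ aeval β Q = 0 ∧ ‖α - β‖ ≤ r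

/-- `M_{ℓ₁,ℓ₂} = ℓ₁ P + ℓ₂ Q`. -/
noncomputable def polyM (P Q : ℤ[X]) (l₁ l₂ : ℤ) : ℤ[X] := C l₁ * P + C l₂ * Q

/-- `S_ℓ = ℓ P + Q`. -/
noncomputable def polyS (P Q : ℤ[X]) (l : ℤ) : ℤ[X] := C l * P + Q

/-- `R_ℓ = P + ℓ Q`. -/
noncomputable def polyR (P Q : ℤ[X]) (l : ℤ) : ℤ[X] := P + C l * Q

/-- The number of positive divisors of a (non-zero) integer. -/
def tauInt (a : ℤ) : ℕ := a.natAbs.divisors.card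

/-- `Γ(P,Q,H) = τ(c_n) τ(d_0) log H`. -/
noncomputable def bigGamma (P Q : ℤ[X]) (H : ℝ) : ℝ :=
  tauInt P.leadingCoeff * tauInt (Q.coeff 0) * Real.log H

/-- `Γ'(P,Q,H) = τ(c_n) τ(d_0) log H / log log H`. -/
noncomputable def bigGamma' (P Q : ℤ[X]) (H : ℝ) : ℝ :=
  tauInt P.leadingCoeff * tauInt (Q.coeff 0) * (Real.log H / Real.log (Real.log H))

/-- `θ_2 = 1` and `θ_n = 2n - 4` for `n ≥ 3`. -/
noncomputable def thetaExp (n : ℕ) : ℝ := if n = 2 then 1 else 2 * (n : ℝ) - 4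

/-- A positive quantity `δ(n, ε)` given by an algorithm: it is the reciprocal of a positive integer
that a recursive function computes from `n` and from the rational lower bound `1 / ⌈1/ε⌉`
of `ε`. For a threshold that may be lowered freely, and that serves all larger `ε` as well, this
is no restriction on what "effectively computable" means. -/
def EffectivelyComputable (δ : ℕ → ℝ → ℝ) : Prop :=
  ∃ D : ℕ → ℕ → ℕ, Computable₂ D ∧
    ∀ (n : ℕ) (ε : ℝ), 0 < ε → δ n ε = 1 / ((D n ⌈1 / ε⌉₊ : ℝ) + 1)

/-! Let `β` be a root of `Q` close to a root `α` of `P`, with `|β| ≤ 2`. Since `Q(β) = 0` and `X ∣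
P`, the value of `M = l₁P + l₂Q` at `β` is `l₁ β (P/X)(β)`, which is `|β|` times something tiny
(`AdmissiblePair.norm_aeval_polyM_le`). If `M = G K`, then `G(β) K(β)` is equally small. The aim is
to show that this can happen only rarely.

Write `lc G = a u` and `G(0) = b v` with `a ∣ c_n`, `u ∣ l₁`, `b ∣ d₀`, `v ∣ l₂`, and sort the
factorizations by `a`, `b`, `deg G` and the dyadic size of the height of `G`. There are `≪ₙ Γ`
classes. Let `G`, `G'` come from two factorizations in one class. They are coprime, because two
non-proportional combinations of `P` and `Q` are. Cross-multiplying by the small numbers `u`, `u'`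
and `v`, `v'` gives one combination without leading term and another divisible by `X`. Hence a
Sylvester determinant of size at most `2e - 2`, where `e = deg G`, suffices to show that `G` and
`G'` cannot both be small at `β` (`valueBound_or_valueBound`). The same holds for the cofactors `K`,
`K'`. Among three members of a class, at most one has a too small `G(β)` and at most one a too small
`K(β)`, so some member has both values large, against the smallness of the product
(`one_le_of_valueBounds`). Every class therefore has at most two members
(`AdmissiblePair.card_le_of_norm_le_two`). The case `|β| > 2` is reduced to this by passing to
reciprocal polynomials.

If both factors have degree at least `m`, the argument needs `r` below `H` to the power `-(1 + (2(n
- m) - 3))`, with truncated subtraction. For `m = 1` this is `θ_n`. For a prime parameter, linear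
factors are counted separately, so `m = 2` is available and gives `2n - 6`.

The count of linear factors needs no close roots: the coefficients of such a factor are divisors of
`c_n` and `d₀`, up to a factor `l` in one of them, and each choice makes `l` a root of a nonzero
polynomial of degree at most `n` (`AdmissiblePair.ncard_linearPrimes_le`). For `n ≤ 3` every
reducible polynomial has a linear factor, which settles that case.

Irreducible members are abundant because the exceptions number `H^{o(1)}` by the divisor bound,
whereas Chebyshev's estimate supplies many primes and an elementary count many pairs. -/

/-- The image of an integer polynomial in `ℚ[X]`. -/
noncomputable abbrev toRat (P : ℤ[X]) : ℚ[X] := P.map (Int.castRingHom ℚ)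

/-! ### Common factors over the integers and over the rationals. -/

theorem natDegree_toRat (P : ℤ[X]) : (toRat P).natDegree = P.natDegree :=
  natDegree_map_eq_of_injective (RingHom.injective_int _) P

theorem toRat_ne_zero {P : ℤ[X]} (hP : P ≠ 0) : toRat P ≠ 0 :=
  (Polynomial.map_ne_zero_iff (RingHom.injective_int _)).2 hP

/-- Gauss's lemma: clearing denominators in an irreducible rational common factor and taking the
primitive part gives a common factor over `ℤ` of the same degree. -/
theorem NoCommonFactor.isCoprime {P Q : ℤ[X]} (h : NoCommonFactor P Q) (hP : P ≠ 0) :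
    IsCoprime (toRat P) (toRat Q) := by
  refine isCoprime_of_irreducible_dvd (fun hh => toRat_ne_zero hP hh.1) ?_
  intro z hz hzP hzQ
  have hz0 := hz.ne_zero
  set N := (IsLocalization.integerNormalization (nonZeroDivisors ℤ) z) with hN
  obtain ⟨c, hc0, hc⟩ := IsLocalization.integerNormalization_spec (nonZeroDivisors ℤ) z
  have hcQ : ((c : ℤ) : ℚ) ≠ 0 := by
    exact_mod_cast nonZeroDivisors.ne_zero hc0
  have hNz : toRat N = C (c : ℚ) * z := by
    have h1 : toRat N = c • z := hc
    rw [h1]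
    ext i
    simp
  have hN0 : N ≠ 0 := by
    intro h0
    rw [h0] at hNz
    simp only [toRat, Polynomial.map_zero] at hNz
    exact mul_ne_zero (C_ne_zero.2 hcQ) hz0 hNz.symm
  have hcont : ((N.content : ℤ) : ℚ) ≠ 0 := by
    exact_mod_cast (content_eq_zero_iff.not.2 hN0)
  have hpp : toRat N.primPart = C ((c : ℚ) * ((N.content : ℤ) : ℚ)⁻¹) * z := by
    have h1 : toRat N = C ((N.content : ℤ) : ℚ) * toRat N.primPart := by
      conv_lhs => rw [N.eq_C_content_mul_primPart]
      simp [toRat]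
    rw [hNz] at h1
    rw [mul_comm (c : ℚ), C_mul, mul_assoc, h1, ← mul_assoc, ← C_mul, inv_mul_cancel₀ hcont]
    simp
  have hunit : IsUnit (C ((c : ℚ) * ((N.content : ℤ) : ℚ)⁻¹)) :=
    isUnit_C.2 (isUnit_iff_ne_zero.2 (mul_ne_zero hcQ (inv_ne_zero hcont)))
  have hd : ∀ F : ℤ[X], z ∣ toRat F → N.primPart ∣ F := by
    intro F hF
    rw [IsPrimitive.Int.dvd_iff_map_cast_dvd_map_cast _ _ N.isPrimitive_primPart]
    change toRat N.primPart ∣ toRat F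
    rw [hpp]
    exact (hunit.mul_left_dvd).2 hF
  have hdeg := h _ (hd P hzP) (hd Q hzQ)
  rw [← natDegree_toRat, hpp, natDegree_C_mul (mul_ne_zero hcQ (inv_ne_zero hcont))] at hdeg
  exact hz.natDegree_pos.ne' hdeg

/-! ### Sylvester determinants and simultaneous small values. -/

/-- A determinant with entries of modulus at most `h ≥ 0`, except that the entries of
one column are of modulus at most `w`. -/
theorem Matrix.norm_det_updateCol_le {N : ℕ} (S : Matrix (Fin N) (Fin N) ℂ) (v : Fin N → ℂ)
    (i : Fin N) {h w : ℝ} (hS : ∀ i j, ‖S i j‖ ≤ h) (hv : ∀ i, ‖v i‖ ≤ w) :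
    ‖(S.updateCol i v).det‖ ≤ N.factorial * (h ^ (N - 1) * w) := by
  have h0 : 0 ≤ h := (norm_nonneg _).trans (hS i i)
  rw [Matrix.det_apply]
  refine (norm_sum_le _ _).trans ?_
  have : ∀ σ ∈ (Finset.univ : Finset (Equiv.Perm (Fin N))),
      ‖Equiv.Perm.sign σ • ∏ j, S.updateCol i v (σ j) j‖ ≤ h ^ (N - 1) * w := by
    intro σ _
    have h1 : ‖Equiv.Perm.sign σ • ∏ j, S.updateCol i v (σ j) j‖
        = ‖∏ j, S.updateCol i v (σ j) j‖ := by
      rcases Int.units_eq_one_or (Equiv.Perm.sign σ) with h | h <;> simp [h]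
    rw [h1, norm_prod, ← Finset.mul_prod_erase _ _ (Finset.mem_univ i), mul_comm]
    have h2 : ∏ x ∈ Finset.univ.erase i, ‖S.updateCol i v (σ x) x‖ ≤ h ^ (N - 1) := by
      calc _ ≤ ∏ x ∈ (Finset.univ.erase i : Finset (Fin N)), h := by
            refine Finset.prod_le_prod (fun _ _ => norm_nonneg _) fun x hx => ?_
            rw [Matrix.updateCol_ne (Finset.ne_of_mem_erase hx)]
            exact hS _ _
        _ = _ := by simp [Finset.card_erase_of_mem]
    refine mul_le_mul h2 ?_ (norm_nonneg _) (pow_nonneg h0 _)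
    simpa using hv _
  refine (Finset.sum_le_card_nsmul _ _ _ this).trans (le_of_eq ?_)
  simp [Fintype.card_perm]

/-- Cramer's rule: the row vector of powers of `z` times `S` is small, and its entry at index `0` is
`1`. So the determinant equals one in which a whole column is replaced by small numbers. -/
theorem norm_det_le_of_vecMul {N : ℕ} (hN : 0 < N) (S : Matrix (Fin N) (Fin N) ℂ) {z : ℂ}
    {h w : ℝ} (hS : ∀ i j, ‖S i j‖ ≤ h)
    (hw : ∀ j, ‖∑ i : Fin _, z ^ (i : ℕ) * S i j‖ ≤ w) :
    ‖S.det‖ ≤ N.factorial * (h ^ (N - 1) * w) := by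
  have : NeZero N := ⟨hN.ne'⟩
  have key : S.transpose.det • (fun i : Fin N => z ^ (i : ℕ))
      = Matrix.cramer S.transpose (S.transpose.mulVec fun i : Fin N => z ^ (i : ℕ)) := by
    rw [Matrix.cramer_eq_adjugate_mulVec, Matrix.mulVec_mulVec, Matrix.adjugate_mul,
      Matrix.smul_mulVec, Matrix.one_mulVec]
  have k0 := congrFun key 0
  rw [Matrix.cramer_apply] at k0
  simp only [Matrix.det_transpose, Pi.smul_apply, Fin.val_zero, pow_zero, smul_eq_mul, mul_one]
    at k0
  rw [k0]
  refine Matrix.norm_det_updateCol_le _ _ _ (fun i j => hS j i) fun j => ?_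
  refine le_trans (le_of_eq ?_) (hw j)
  simp [Matrix.mulVec, dotProduct, mul_comm]

/-- The columns of a Sylvester matrix are shifted coefficient vectors, so pairing one with the
powers of `z` evaluates the polynomial, up to the shift `z ^ j`. -/
theorem sum_shifted_coeff {F : ℤ[X]} {s N j : ℕ} (hs : F.natDegree = s) (hj : j + s < N) (z : ℂ) :
    ∑ i : Fin N, z ^ (i : ℕ) *
      (if (i : ℕ) ∈ Set.Icc j (j + s) then (F.coeff (i - j) : ℂ) else 0) = z ^ j * aeval z F := by
  rw [Fin.sum_univ_eq_sum_range (fun i => z ^ i *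
      (if i ∈ Set.Icc j (j + s) then (F.coeff (i - j) : ℂ) else 0)) N]
  have : aeval z F = ∑ k ∈ Finset.range (s + 1), (F.coeff k : ℂ) * z ^ k := by
    rw [aeval_eq_sum_range, hs]
    simp
  rw [this, Finset.mul_sum]
  symm
  refine Finset.sum_bij_ne_zero (fun k _ _ => k + j) ?_ ?_ ?_ ?_
  · intro k hk _
    simp only [Finset.mem_range] at hk ⊢
    omega
  · intro a _ _ b _ _ hab
    omega
  · intro i hi hne
    by_cases hm : i ∈ Set.Icc j (j + s)
    · rw [if_pos hm] at hne
      refine ⟨i - j, ?_, ?_, ?_⟩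
      · simp only [Finset.mem_range]
        have := hm.2
        omega
      · have e : z ^ i = z ^ j * z ^ (i - j) := by
          rw [← pow_add]; congr 1; have := hm.1; omega
        rw [e] at hne
        intro h0
        apply hne
        rw [← h0]; ring
      · have := hm.1
        omega
    · rw [if_neg hm] at hne
      simp at hne
  · intro k hk _
    have : k + j ∈ Set.Icc j (j + s) := by
      simp only [Finset.mem_range] at hk
      exact ⟨by omega, by omega⟩
    rw [if_pos this, Nat.add_sub_cancel, pow_add]
    ring

/-- Two coprime integer polynomials with small coefficients cannot both be very small at a point. -/
theorem one_le_of_isCoprime {A B : ℤ[X]} (hAB : IsCoprime (toRat A) (toRat B)) {N : ℕ}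
    (hdeg : A.natDegree + B.natDegree ≤ N) {h μ : ℝ} (hh : 1 ≤ h)
    (hA : ∀ i, |(A.coeff i : ℝ)| ≤ h) (hB : ∀ i, |(B.coeff i : ℝ)| ≤ h) {z : ℂ} (hz : ‖z‖ ≤ 2)
    (hμA : ‖aeval z A‖ ≤ μ) (hμB : ‖aeval z B‖ ≤ μ) :
    1 ≤ N.factorial * (h ^ (N - 1) * (2 ^ N * μ)) := by
  have hμ : 0 ≤ μ := (norm_nonneg _).trans hμA
  have hf : (1 : ℝ) ≤ N.factorial := by exact_mod_cast N.factorial_pos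
  -- For two constants the Sylvester matrix is empty; then one of them is a nonzero integer, and its
  -- value is already at least `1`.
  rcases Nat.eq_zero_or_pos (A.natDegree + B.natDegree) with h0 | hpos
  · have h1 : 1 ≤ μ := by
      have hA0 : A.natDegree = 0 := by omega
      have hB0 : B.natDegree = 0 := by omega
      rw [natDegree_eq_zero] at hA0 hB0
      obtain ⟨a, rfl⟩ := hA0
      obtain ⟨b, rfl⟩ := hB0
      have : a ≠ 0 ∨ b ≠ 0 := by
        by_contra hcon
        push Not at hcon
        rw [hcon.1, hcon.2] at hAB
        simp only [toRat, map_zero, Polynomial.map_zero] at hAB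
        exact not_isCoprime_zero_zero hAB
      rcases this with h | h
      · refine le_trans ?_ hμA
        simp only [eq_intCast, map_intCast, Complex.norm_intCast]
        exact_mod_cast Int.one_le_abs h
      · refine le_trans ?_ hμB
        simp only [eq_intCast, map_intCast, Complex.norm_intCast]
        exact_mod_cast Int.one_le_abs h
    have h2 : (1 : ℝ) ≤ h ^ (N - 1) := one_le_pow₀ hh
    have h3 : (1 : ℝ) ≤ 2 ^ N := one_le_pow₀ (by norm_num)
    exact one_le_mul_of_one_le_of_one_le hf
      (one_le_mul_of_one_le_of_one_le h2 (one_le_mul_of_one_le_of_one_le h3 h1))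
  · set s := A.natDegree with hs
    set t := B.natDegree with ht
    let S : Matrix (Fin (s + t)) (Fin (s + t)) ℂ :=
      (Int.castRingHom ℂ).mapMatrix (sylvester A B s t)
    have hdetZ : (sylvester A B s t).det ≠ 0 := by
      intro hd
      have := resultant_ne_zero _ _ hAB
      rw [natDegree_toRat, natDegree_toRat, ← hs, ← ht] at this
      apply this
      rw [resultant, sylvester_map_map, ← RingHom.map_det, hd, map_zero]
    -- The resultant is a nonzero integer.
    have hdet : 1 ≤ ‖S.det‖ := by
      rw [← RingHom.map_det]
      simp only [eq_intCast, Complex.norm_intCast]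
      exact_mod_cast Int.one_le_abs hdetZ
    have hcol : ∀ j, ‖∑ i : Fin _, z ^ (i : ℕ) * S i j‖ ≤ 2 ^ (s + t) * μ := by
      have hpow : ∀ j : ℕ, j ≤ s + t → ∀ x : ℂ, ‖x‖ ≤ μ → ‖z ^ j * x‖ ≤ 2 ^ (s + t) * μ := by
        intro j hj x hx
        rw [norm_mul, norm_pow]
        refine mul_le_mul ?_ hx (norm_nonneg _) (by positivity)
        calc ‖z‖ ^ j ≤ 2 ^ j := pow_le_pow_left₀ (norm_nonneg _) hz j
          _ ≤ 2 ^ (s + t) := pow_le_pow_right₀ (by norm_num) hj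
      intro j
      refine j.addCases (fun j => ?_) (fun j => ?_)
      · have e : ∑ i : Fin _, z ^ (i : ℕ) * S i (Fin.castAdd t j) = z ^ (j : ℕ) * aeval z B := by
          rw [← sum_shifted_coeff ht.symm (by omega : (j : ℕ) + t < s + t) z]
          refine Finset.sum_congr rfl fun i _ => ?_
          simp only [S, RingHom.mapMatrix_apply, Matrix.map_apply, sylvester, Matrix.of_apply,
            Fin.addCases_left]
          split_ifs <;> simp
        rw [e]
        exact hpow _ (by omega) _ hμB
      · have e : ∑ i : Fin _, z ^ (i : ℕ) * S i (Fin.natAdd s j) = z ^ (j : ℕ) * aeval z A := by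
          rw [← sum_shifted_coeff hs.symm (by omega : (j : ℕ) + s < s + t) z]
          refine Finset.sum_congr rfl fun i _ => ?_
          simp only [S, RingHom.mapMatrix_apply, Matrix.map_apply, sylvester, Matrix.of_apply,
            Fin.addCases_right]
          split_ifs <;> simp
        rw [e]
        exact hpow _ (by omega) _ hμA
    have hent : ∀ i j, ‖S i j‖ ≤ h := by
      intro i j
      refine j.addCases (fun j => ?_) (fun j => ?_)
      · simp only [S, RingHom.mapMatrix_apply, Matrix.map_apply, sylvester, Matrix.of_apply,
            Fin.addCases_left]
        split_ifs
        · simpa using hB _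
        · simpa using zero_le_one.trans hh
      · simp only [S, RingHom.mapMatrix_apply, Matrix.map_apply, sylvester, Matrix.of_apply,
            Fin.addCases_right]
        split_ifs
        · simpa using hA _
        · simpa using zero_le_one.trans hh
    have := hdet.trans (norm_det_le_of_vecMul hpos S hent hcol)
    refine this.trans ?_
    have hfac : ((s + t).factorial : ℝ) ≤ N.factorial := by
      exact_mod_cast Nat.factorial_le hdeg
    gcongr
    norm_num

/-! ### Heights and their behaviour under multiplication. -/

theorem abs_coeff_le_naiveHeight (P : ℤ[X]) (i : ℕ) : |(P.coeff i : ℝ)| ≤ naiveHeight P := by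
  have h : (P.coeff i).natAbs ≤ naiveHeight P := by
    by_cases hi : i ∈ P.support
    · exact Finset.le_sup (f := fun i => (P.coeff i).natAbs) hi
    · rw [notMem_support_iff.1 hi]
      simp
  rw [← Int.cast_abs, Int.abs_eq_natAbs, Int.cast_natCast]
  exact_mod_cast h

theorem naiveHeight_le {P : ℤ[X]} {B : ℝ} (hB : 0 ≤ B) (h : ∀ i, |(P.coeff i : ℝ)| ≤ B) :
    (naiveHeight P : ℝ) ≤ B := by
  rw [← Nat.le_floor_iff hB]
  refine Finset.sup_le fun i _ => ?_
  rw [Nat.le_floor_iff hB]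
  have := h i
  rwa [← Int.cast_abs, Int.abs_eq_natAbs, Int.cast_natCast] at this

theorem exists_coeff_eq_naiveHeight (P : ℤ[X]) : ∃ i, |(P.coeff i : ℝ)| = naiveHeight P := by
  by_cases hP : P.support.Nonempty
  · obtain ⟨i, _, hi⟩ := Finset.exists_mem_eq_sup P.support hP fun i => (P.coeff i).natAbs
    refine ⟨i, ?_⟩
    rw [← Int.cast_abs, Int.abs_eq_natAbs, Int.cast_natCast, naiveHeight, hi]
  · rw [Finset.not_nonempty_iff_eq_empty, support_eq_empty] at hP
    exact ⟨0, by simp [hP, naiveHeight]⟩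

theorem one_le_naiveHeight {P : ℤ[X]} (hP : P ≠ 0) : 1 ≤ naiveHeight P := by
  have h := abs_coeff_le_naiveHeight P P.natDegree
  have h1 : (1 : ℝ) ≤ |(P.coeff P.natDegree : ℝ)| := by
    exact_mod_cast Int.one_le_abs (leadingCoeff_ne_zero.2 hP)
  exact_mod_cast h1.trans h

/-- The Mahler measure is multiplicative, bounds each coefficient up to a binomial coefficient, and
is at most the sum of the moduli of the coefficients. -/
theorem naiveHeight_mul_le {n : ℕ} {G K : ℤ[X]} (hGK : G * K ≠ 0) (hn : (G * K).natDegree = n) :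
    (naiveHeight G : ℝ) * naiveHeight K ≤ 2 ^ n * (n + 1) * naiveHeight (G * K) := by
  have hG : G ≠ 0 := left_ne_zero_of_mul hGK
  have hK : K ≠ 0 := right_ne_zero_of_mul hGK
  let φ := Int.castRingHom ℂ
  have hdeg : ∀ F : ℤ[X], (F.map φ).natDegree = F.natDegree := fun F =>
    natDegree_map_eq_of_injective (RingHom.injective_int φ) F
  have key : ∀ F : ℤ[X], (naiveHeight F : ℝ) ≤ 2 ^ F.natDegree * (F.map φ).mahlerMeasure := by
    intro F
    obtain ⟨i, hi⟩ := exists_coeff_eq_naiveHeight F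
    have h := norm_coeff_le_choose_mul_mahlerMeasure i (F.map φ)
    rw [coeff_map, hdeg] at h
    have h1 : ‖φ (F.coeff i)‖ = naiveHeight F := by
      rw [← hi]
      simp [φ]
    rw [h1] at h
    refine h.trans (mul_le_mul_of_nonneg_right ?_ (mahlerMeasure_nonneg _))
    exact_mod_cast Nat.choose_le_two_pow F.natDegree i
  have hM : ((G * K).map φ).mahlerMeasure ≤ (n + 1) * naiveHeight (G * K) := by
    refine (mahlerMeasure_le_sum_norm_coeff _).trans ?_
    rw [sum_over_range _ (by simp), hdeg, hn]
    refine (Finset.sum_le_card_nsmul _ _ (naiveHeight (G * K) : ℝ) fun i _ => ?_).trans ?_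
    · rw [coeff_map]
      simpa [φ] using abs_coeff_le_naiveHeight (G * K) i
    · simp
  have hadd : G.natDegree + K.natDegree = n := by rw [← hn, natDegree_mul hG hK]
  calc (naiveHeight G : ℝ) * naiveHeight K
      ≤ (2 ^ G.natDegree * (G.map φ).mahlerMeasure) *
          (2 ^ K.natDegree * (K.map φ).mahlerMeasure) := by
        refine mul_le_mul (key G) (key K) (by positivity) ?_
        exact mul_nonneg (by positivity) (mahlerMeasure_nonneg _)
    _ = 2 ^ n * ((G * K).map φ).mahlerMeasure := by
        rw [Polynomial.map_mul, mahlerMeasure_mul, ← hadd, pow_add]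
        ring
    _ ≤ 2 ^ n * ((n + 1) * naiveHeight (G * K)) := by gcongr
    _ = _ := by ring

/-! ### Lipschitz bounds on the disc of radius `3`. -/

theorem norm_pow_sub_pow_le {z w : ℂ} (hz : ‖z‖ ≤ 3) (hw : ‖w‖ ≤ 3) (i : ℕ) :
    ‖z ^ i - w ^ i‖ ≤ i * 3 ^ i * ‖z - w‖ := by
  induction i with
  | zero => simp
  | succ i ih =>
    have e : z ^ (i + 1) - w ^ (i + 1) = z * (z ^ i - w ^ i) + (z - w) * w ^ i := by ring
    rw [e]
    refine (norm_add_le _ _).trans ?_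
    rw [norm_mul, norm_mul, norm_pow]
    have h1 : ‖z‖ * ‖z ^ i - w ^ i‖ ≤ 3 * (i * 3 ^ i * ‖z - w‖) :=
      mul_le_mul hz ih (norm_nonneg _) (by norm_num)
    have h2 : ‖z - w‖ * ‖w‖ ^ i ≤ ‖z - w‖ * 3 ^ i :=
      mul_le_mul_of_nonneg_left (pow_le_pow_left₀ (norm_nonneg _) hw i) (norm_nonneg _)
    have h3 : 0 ≤ ‖z - w‖ * 3 ^ i := by positivity
    push_cast
    rw [pow_succ]
    nlinarith

theorem norm_aeval_sub_aeval_le {F : ℤ[X]} {n : ℕ} (hF : F.natDegree ≤ n) {h : ℝ}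
    (hc : ∀ i, |(F.coeff i : ℝ)| ≤ h) {z w : ℂ} (hz : ‖z‖ ≤ 3) (hw : ‖w‖ ≤ 3) :
    ‖aeval z F - aeval w F‖ ≤ (n + 1) * (n * 3 ^ n) * (h * ‖z - w‖) := by
  have h0 : 0 ≤ h := (abs_nonneg _).trans (hc 0)
  rw [aeval_eq_sum_range' (Nat.lt_succ_of_le hF), aeval_eq_sum_range' (Nat.lt_succ_of_le hF),
    ← Finset.sum_sub_distrib]
  refine (norm_sum_le _ _).trans ?_
  refine (Finset.sum_le_card_nsmul _ _ ((n * 3 ^ n) * (h * ‖z - w‖)) fun i hi => ?_).trans ?_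
  · have hin : i ≤ n := by simpa [Nat.lt_succ_iff] using hi
    rw [← smul_sub, zsmul_eq_mul, norm_mul, Complex.norm_intCast]
    have h1 : ‖z ^ i - w ^ i‖ ≤ n * 3 ^ n * ‖z - w‖ := by
      refine (norm_pow_sub_pow_le hz hw i).trans ?_
      gcongr
      norm_num
    calc |(F.coeff i : ℝ)| * ‖z ^ i - w ^ i‖ ≤ h * (n * 3 ^ n * ‖z - w‖) :=
          mul_le_mul (hc i) h1 (norm_nonneg _) h0
      _ = _ := by ring
  · simp only [Finset.card_range, nsmul_eq_mul]
    push_cast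
    exact le_of_eq (by ring)

theorem one_le_norm_intCast {a : ℤ} (ha : a ≠ 0) : 1 ≤ ‖(a : ℂ)‖ := by
  rw [Complex.norm_intCast]
  exact_mod_cast Int.one_le_abs ha

/-! ### Lower bounds for one of two coprime polynomials with related outer coefficients. -/

theorem IsCoprime.of_mul_combination {R : Type*} [CommRing R] {p q u v : R} (h : IsCoprime p q)
    {a b c d : R} (hu : u = a * p + b * q) (hv : v = c * p + d * q)
    (hdet : IsUnit (a * d - b * c)) : IsCoprime u v := by
  obtain ⟨x, y, hxy⟩ := h
  obtain ⟨e, he⟩ := hdet.exists_left_inv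
  refine ⟨e * (x * d - y * c), e * (y * a - x * b), ?_⟩
  rw [hu, hv]
  calc _ = (e * (a * d - b * c)) * (x * p + y * q) := by ring
    _ = 1 := by rw [he, hxy, one_mul]

theorem isCoprime_toRat_combination {p q u v : ℤ[X]} (h : IsCoprime (toRat p) (toRat q))
    {a b c d : ℤ} (hu : u = C a * p + C b * q) (hv : v = C c * p + C d * q)
    (hdet : a * d - b * c ≠ 0) : IsCoprime (toRat u) (toRat v) := by
  refine h.of_mul_combination (a := C (a : ℚ)) (b := C (b : ℚ)) (c := C (c : ℚ)) (d := C (d : ℚ))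
    (by simp [hu, toRat]) (by simp [hv, toRat]) ?_
  rw [← C_mul, ← C_mul, ← C_sub, isUnit_C, isUnit_iff_ne_zero]
  exact_mod_cast hdet

/-- `x` is a lower bound for the value at a point of modulus `t` of a polynomial of degree `e`
and height at most `h` (with the implied constant `κ`). -/
structure ValueBound (e : ℕ) (h t κ : ℝ) (x : ℝ) : Prop where
  linear : e = 1 → 1 ≤ κ * x
  nonlinear : 2 ≤ e → t ≤ κ * h ^ (2 * e - 3) * x

theorem natDegree_linearCombination_lt {e : ℕ} (he : 1 ≤ e) {G G' : ℤ[X]} (hG : G.natDegree = e)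
    (hG' : G'.natDegree = e) {u v : ℤ} (h : u * G.leadingCoeff = v * G'.leadingCoeff) :
    (C u * G - C v * G').natDegree ≤ e - 1 := by
  rw [natDegree_le_iff_coeff_eq_zero]
  intro i hi
  rw [coeff_sub, coeff_C_mul, coeff_C_mul]
  rcases eq_or_lt_of_le (show e ≤ i by omega) with rfl | hlt
  · have e1 : G.coeff e = G.leadingCoeff := by rw [leadingCoeff, hG]
    have e2 : G'.coeff e = G'.leadingCoeff := by rw [leadingCoeff, hG']
    rw [e1, e2, h, sub_self]
  · rw [coeff_eq_zero_of_natDegree_lt (by omega), coeff_eq_zero_of_natDegree_lt (by omega)]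
    simp

theorem abs_coeff_linearCombination_le {G G' : ℤ[X]} {u v : ℤ} {L h : ℝ} (hu : |(u : ℝ)| ≤ L)
    (hv : |(v : ℝ)| ≤ L) (hG : ∀ i, |(G.coeff i : ℝ)| ≤ h) (hG' : ∀ i, |(G'.coeff i : ℝ)| ≤ h)
    (i : ℕ) : |((C u * G - C v * G').coeff i : ℝ)| ≤ 2 * L * h := by
  have hL : 0 ≤ L := (abs_nonneg _).trans hu
  rw [coeff_sub, coeff_C_mul, coeff_C_mul]
  push_cast
  refine (abs_sub _ _).trans ?_
  rw [abs_mul, abs_mul]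
  have h1 := mul_le_mul hu (hG i) (abs_nonneg _) hL
  have h2 := mul_le_mul hv (hG' i) (abs_nonneg _) hL
  linarith

theorem norm_aeval_linearCombination_le {G G' : ℤ[X]} {u v : ℤ} {L μ : ℝ} (hu : |(u : ℝ)| ≤ L)
    (hv : |(v : ℝ)| ≤ L) {z : ℂ} (hG : ‖aeval z G‖ ≤ μ) (hG' : ‖aeval z G'‖ ≤ μ) :
    ‖aeval z (C u * G - C v * G')‖ ≤ 2 * L * μ := by
  have hL : 0 ≤ L := (abs_nonneg _).trans hu
  simp only [map_sub, map_mul, eq_intCast, map_intCast]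
  refine (norm_sub_le _ _).trans ?_
  rw [norm_mul, norm_mul, Complex.norm_intCast, Complex.norm_intCast]
  have h1 := mul_le_mul hu hG (norm_nonneg _) hL
  have h2 := mul_le_mul hv hG' (norm_nonneg _) hL
  linarith

/-- The constant in the lower bounds for the values of two coprime polynomials of degree at most
`n` whose outer coefficients agree up to factors of modulus at most `L`. -/
noncomputable def pairConst (n : ℕ) (L : ℝ) : ℝ :=
  (2 * n).factorial * 2 ^ (2 * n) * (2 * L) ^ (2 * n) * (4 * L)

theorem four_mul_le_pairConst (n : ℕ) {L : ℝ} (hL : 1 ≤ L) : 4 * L ≤ pairConst n L := by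
  have hf : (1 : ℝ) ≤ (2 * n).factorial := by exact_mod_cast (2 * n).factorial_pos
  have h2 : (1 : ℝ) ≤ 2 ^ (2 * n) := one_le_pow₀ (by norm_num)
  have h3 : 1 ≤ (2 * L) ^ (2 * n) := one_le_pow₀ (by linarith)
  unfold pairConst
  have := one_le_mul_of_one_le_of_one_le (one_le_mul_of_one_le_of_one_le hf h2) h3
  exact le_mul_of_one_le_left (by positivity) this

theorem le_pairConst_of_isCoprime {e n : ℕ} (he : 2 ≤ e) (hen : e ≤ n) {A B : ℤ[X]}
    (hAB : IsCoprime (toRat A) (toRat B)) (hdeg : A.natDegree + B.natDegree ≤ 2 * e - 2)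
    {L h μ : ℝ} (hL : 1 ≤ L) (hh : 1 ≤ h) (hA : ∀ i, |(A.coeff i : ℝ)| ≤ 2 * L * h)
    (hB : ∀ i, |(B.coeff i : ℝ)| ≤ 2 * L * h) {z : ℂ} (hz0 : z ≠ 0) (hz : ‖z‖ ≤ 2)
    (hμA : ‖aeval z A‖ ≤ 4 * L * μ / ‖z‖) (hμB : ‖aeval z B‖ ≤ 4 * L * μ / ‖z‖) :
    ‖z‖ ≤ pairConst n L * h ^ (2 * e - 3) * μ := by
  have hz' : 0 < ‖z‖ := norm_pos_iff.2 hz0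
  have hμ : 0 ≤ μ := by
    by_contra hneg
    push Not at hneg
    have : 4 * L * μ / ‖z‖ < 0 := div_neg_of_neg_of_pos (by nlinarith) hz'
    linarith [norm_nonneg (aeval z A)]
  have h1 := one_le_of_isCoprime hAB hdeg (by nlinarith : 1 ≤ 2 * L * h) hA hB hz hμA hμB
  have e1 : 2 * e - 2 - 1 = 2 * e - 3 := by omega
  rw [e1] at h1
  have h2 : ‖z‖ ≤ (2 * e - 2).factorial * ((2 * L * h) ^ (2 * e - 3) *
      (2 ^ (2 * e - 2) * (4 * L * μ))) := by
    have := mul_le_mul_of_nonneg_left h1 hz'.le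
    rw [mul_one] at this
    refine this.trans (le_of_eq ?_)
    field_simp
  refine h2.trans ?_
  have hf : ((2 * e - 2).factorial : ℝ) ≤ (2 * n).factorial := by
    exact_mod_cast Nat.factorial_le (by omega)
  have hp : (2 : ℝ) ^ (2 * e - 2) ≤ 2 ^ (2 * n) :=
    pow_le_pow_right₀ (by norm_num) (by omega)
  have hq : (2 * L) ^ (2 * e - 3) ≤ (2 * L) ^ (2 * n) :=
    pow_le_pow_right₀ (by linarith) (by omega)
  calc _ = ((2 * e - 2).factorial : ℝ) * 2 ^ (2 * e - 2) * (2 * L) ^ (2 * e - 3) * (4 * L)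
        * h ^ (2 * e - 3) * μ := by rw [mul_pow]; ring
    _ ≤ _ := by
        unfold pairConst
        gcongr

/-- Of two coprime integer polynomials of the same degree whose leading and constant coefficients
agree up to small factors, at least one is not too small at `z`. -/
theorem valueBound_or_valueBound {e n : ℕ} (he : 1 ≤ e) (hen : e ≤ n) {G G' : ℤ[X]}
    (hG : G.natDegree = e) (hG' : G'.natDegree = e) (hcop : IsCoprime (toRat G) (toRat G'))
    {a b u u' v v' : ℤ} (hlc : G.leadingCoeff = a * u) (hlc' : G'.leadingCoeff = a * u')
    (h0 : G.coeff 0 = b * v) (h0' : G'.coeff 0 = b * v') (hb : b ≠ 0) (hv : v ≠ 0)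
    {L h : ℝ} (hL : 1 ≤ L) (hh : 1 ≤ h) (hu1 : |(u : ℝ)| ≤ L) (hu1' : |(u' : ℝ)| ≤ L)
    (hv1 : |(v : ℝ)| ≤ L) (hv1' : |(v' : ℝ)| ≤ L) (hGh : ∀ i, |(G.coeff i : ℝ)| ≤ h)
    (hGh' : ∀ i, |(G'.coeff i : ℝ)| ≤ h) {z : ℂ} (hz0 : z ≠ 0) (hz : ‖z‖ ≤ 2) :
    ValueBound e h ‖z‖ (pairConst n L) ‖aeval z G‖ ∨
      ValueBound e h ‖z‖ (pairConst n L) ‖aeval z G'‖ := by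
  suffices H : ValueBound e h ‖z‖ (pairConst n L) (max ‖aeval z G‖ ‖aeval z G'‖) by
    rcases max_choice ‖aeval z G‖ ‖aeval z G'‖ with hm | hm
    · exact Or.inl (hm ▸ H)
    · exact Or.inr (hm ▸ H)
  set μ := max ‖aeval z G‖ ‖aeval z G'‖ with hμdef
  have hμG : ‖aeval z G‖ ≤ μ := le_max_left _ _
  have hμG' : ‖aeval z G'‖ ≤ μ := le_max_right _ _
  have hμ : 0 ≤ μ := (norm_nonneg _).trans hμG
  have hz' : 0 < ‖z‖ := norm_pos_iff.2 hz0
  have hκ := four_mul_le_pairConst n hL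
  set B₀ := C v' * G - C v * G' with hB₀
  have hB₀0 : B₀.coeff 0 = 0 := by
    rw [hB₀, coeff_sub, coeff_C_mul, coeff_C_mul, h0, h0']
    ring
  have hB₀X : B₀ = X * B₀.divX := by
    conv_lhs => rw [← divX_mul_X_add B₀, hB₀0]
    simp [mul_comm]
  have hBc : ∀ i, |(B₀.divX.coeff i : ℝ)| ≤ 2 * L * h := fun i => by
    rw [coeff_divX]
    exact abs_coeff_linearCombination_le hv1' hv1 hGh hGh' _
  have hdiv : ∀ x : ℝ, x ≤ 2 * L * μ → x ≤ 4 * L * μ / ‖z‖ := by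
    -- The bound `‖z‖ ≤ 2` allows the same majorant for values that were not divided by `z`.
    intro x hx
    rw [le_div_iff₀ hz']
    have hLμ : 0 ≤ L * μ := by positivity
    calc x * ‖z‖ ≤ (2 * L * μ) * ‖z‖ := by gcongr
      _ ≤ (2 * L * μ) * 2 := by gcongr
      _ = 4 * L * μ := by ring
  have hBz : ‖aeval z B₀.divX‖ ≤ 4 * L * μ / ‖z‖ := by
    have h1 := norm_aeval_linearCombination_le hv1' hv1 hμG hμG'
    rw [← hB₀, hB₀X, map_mul, aeval_X, norm_mul] at h1
    rw [le_div_iff₀ hz']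
    have hLμ : 0 ≤ L * μ := by positivity
    linarith
  have hBdeg : B₀.natDegree ≤ e := by
    refine (natDegree_sub_le _ _).trans (max_le ?_ ?_)
    · exact (natDegree_C_mul_le _ _).trans hG.le
    · exact (natDegree_C_mul_le _ _).trans hG'.le
  -- `u' * v - u * v'` is, up to sign, the determinant of the two cancelling combinations. If it
  -- vanishes, `B₀` loses its leading term as well, so `B₀.divX` has degree at most `e - 2` and can
  -- be paired with `G` itself. Otherwise it is paired with the combination `A` of degree at most `e
  -- - 1`. In both cases the degrees add up to at most `2 * e - 2`.
  by_cases hD : u' * v - u * v' = 0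
  · have hBdeg' : B₀.natDegree ≤ e - 1 := by
      refine natDegree_linearCombination_lt he hG hG' ?_
      rw [hlc, hlc']
      linear_combination -a * hD
    have hc : IsCoprime (toRat G) (toRat B₀) :=
      isCoprime_toRat_combination hcop (a := 1) (b := 0) (c := v') (d := -v) (by simp)
        (by rw [hB₀]; simp [sub_eq_add_neg]) (by simpa using hv)
    refine ⟨fun he1 => ?_, fun he2 => ?_⟩
    · exfalso
      have hB0 : B₀ = 0 := by
        rw [eq_C_of_natDegree_le_zero (by omega : B₀.natDegree ≤ 0), hB₀0, C_0]
      rw [hB0] at hc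
      simp only [toRat, Polynomial.map_zero, isCoprime_zero_right] at hc
      have := natDegree_eq_zero_of_isUnit hc
      rw [natDegree_toRat] at this
      omega
    · rw [hB₀X] at hc
      simp only [toRat, Polynomial.map_mul, map_X] at hc
      refine le_pairConst_of_isCoprime he2 hen hc.of_mul_right_right ?_ hL hh (fun i => ?_) hBc
        hz0 hz (hdiv _ ?_) hBz
      · rw [natDegree_divX_eq_natDegree_tsub_one]
        omega
      · exact (hGh i).trans (by nlinarith)
      · exact hμG.trans (by nlinarith)
  · set A := C u' * G - C u * G' with hA
    have hAdeg : A.natDegree ≤ e - 1 := by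
      refine natDegree_linearCombination_lt he hG hG' ?_
      rw [hlc, hlc']
      ring
    have hAz : ‖aeval z A‖ ≤ 2 * L * μ := norm_aeval_linearCombination_le hu1' hu1 hμG hμG'
    have hc : IsCoprime (toRat A) (toRat B₀) :=
      isCoprime_toRat_combination hcop (a := u') (b := -u) (c := v') (d := -v)
        (by rw [hA]; simp [sub_eq_add_neg]) (by rw [hB₀]; simp [sub_eq_add_neg])
        (fun h => hD (by linear_combination -h))
    refine ⟨fun he1 => ?_, fun he2 => ?_⟩
    -- In degree one, `A` is a nonzero integer, so no power of the height is lost.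
    · have hAC : A = C (b * (u' * v - u * v')) := by
        rw [eq_C_of_natDegree_le_zero (by omega : A.natDegree ≤ 0), hA, coeff_sub, coeff_C_mul,
          coeff_C_mul, h0, h0']
        congr 1
        ring
      have h1 : 1 ≤ ‖aeval z A‖ := by
        rw [hAC, aeval_C, algebraMap_int_eq]
        exact one_le_norm_intCast (mul_ne_zero hb hD)
      calc (1 : ℝ) ≤ 2 * L * μ := h1.trans hAz
        _ ≤ 4 * L * μ := by nlinarith [mul_nonneg (zero_le_one.trans hL) hμ]
        _ ≤ _ := by gcongr
    · rw [hB₀X] at hc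
      simp only [toRat, Polynomial.map_mul, map_X] at hc
      refine le_pairConst_of_isCoprime he2 hen hc.of_mul_right_right ?_ hL hh
        (abs_coeff_linearCombination_le hu1' hu1 hGh hGh') hBc hz0 hz (hdiv _ hAz) hBz
      rw [natDegree_divX_eq_natDegree_tsub_one]
      omega

/-- With both outer coefficients equal, the difference is a nonzero integer multiple of `X`. This
saves the height factor in the case of two quadratic factors, where the general bound is too weak
for the exponent `2n - 6` with `n = 4`. -/
theorem norm_le_or_norm_le_of_quadratic {G G' : ℤ[X]} (hG : G.natDegree = 2)
    (hG' : G'.natDegree = 2) (hcop : IsCoprime (toRat G) (toRat G'))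
    (hlc : G.leadingCoeff = G'.leadingCoeff) (h0 : G.coeff 0 = G'.coeff 0) (z : ℂ) :
    ‖z‖ ≤ 2 * ‖aeval z G‖ ∨ ‖z‖ ≤ 2 * ‖aeval z G'‖ := by
  have hc2 : (G - G').natDegree ≤ 1 := by
    simpa using natDegree_linearCombination_lt (e := 2) (by norm_num) hG hG' (u := 1) (v := 1)
      (by simpa using hlc)
  have hB : G - G' = X * C ((G - G').coeff 1) := by
    conv_lhs => rw [eq_X_add_C_of_natDegree_le_one hc2]
    simp [h0, mul_comm]
  have hne : (G - G').coeff 1 ≠ 0 := by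
    intro h
    rw [h, C_0, mul_zero, sub_eq_zero] at hB
    rw [hB, isCoprime_self] at hcop
    have := natDegree_eq_zero_of_isUnit hcop
    rw [natDegree_toRat] at this
    omega
  have h1 : ‖z‖ ≤ ‖aeval z G - aeval z G'‖ := by
    rw [← map_sub, hB, map_mul, aeval_X, norm_mul, aeval_C, algebraMap_int_eq, eq_intCast]
    exact le_mul_of_one_le_right (norm_nonneg _) (one_le_norm_intCast hne)
  have h2 := h1.trans (norm_sub_le _ _)
  by_contra hcon
  push Not at hcon
  linarith [hcon.1, hcon.2]

/-! ### Multiplying the lower bounds for the two factors. -/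

/-- Multiplying the two bounds and cancelling one `t` leaves an upper bound for `t`, which `hkt`
turns into a contradiction-ready inequality at the price of one more factor `k`. Since `k` belongs
to the factor of smaller degree, its exponent `2f - 2` still does not exceed `2e - 3`, and the
heights combine into a power of `h * k`. -/
theorem one_le_of_valueBounds_of_lt {e f E : ℕ} (he : 2 ≤ e) (hf : 2 ≤ f) (hfe : f < e)
    (hE : 2 * e - 3 ≤ E) {h k t κ x y W Y c : ℝ} (ht : 0 < t) (hh : 1 ≤ h) (hk : 1 ≤ k)
    (hκ : 1 ≤ κ) (hc : 1 ≤ c) (hx : 0 ≤ x) (hW : 0 ≤ W) (hY : h * k ≤ Y)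
    (hxy : x * y ≤ W * t) (hG : ValueBound e h t κ x) (hK : ValueBound f k t κ y)
    (hkt : 1 ≤ c * (k * t)) : 1 ≤ c * (κ ^ 2 * Y ^ E * W) := by
  have h1 := hG.nonlinear he
  have h2 := hK.nonlinear hf
  have hY1 : 1 ≤ Y := by nlinarith
  have h3 : t * t ≤ (κ ^ 2 * (h ^ (2 * e - 3) * k ^ (2 * f - 3)) * W) * t :=
    calc t * t ≤ (κ * h ^ (2 * e - 3) * x) * (κ * k ^ (2 * f - 3) * y) :=
          mul_le_mul h1 h2 ht.le (by positivity)
      _ = κ ^ 2 * (h ^ (2 * e - 3) * k ^ (2 * f - 3)) * (x * y) := by ring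
      _ ≤ κ ^ 2 * (h ^ (2 * e - 3) * k ^ (2 * f - 3)) * (W * t) := by gcongr
      _ = _ := by ring
  have h4 := le_of_mul_le_mul_right h3 ht
  calc (1 : ℝ) ≤ c * (k * t) := hkt
    _ ≤ c * (k * (κ ^ 2 * (h ^ (2 * e - 3) * k ^ (2 * f - 3)) * W)) := by gcongr
    _ = c * (κ ^ 2 * (h ^ (2 * e - 3) * k ^ (2 * f - 3 + 1)) * W) := by ring
    _ ≤ c * (κ ^ 2 * (h ^ (2 * e - 3) * k ^ (2 * e - 3)) * W) := by
        gcongr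
        omega
    _ = c * (κ ^ 2 * (h * k) ^ (2 * e - 3) * W) := by rw [mul_pow]
    _ ≤ c * (κ ^ 2 * Y ^ (2 * e - 3) * W) := by gcongr
    _ ≤ _ := by gcongr

/-- If one factor is bounded below by a constant, only a single `t` appears on the left, and it
cancels against the one in `hxy`; no lower bound for `t` is needed. -/
theorem one_le_of_valueBounds_of_half_le {f E : ℕ} (hf : 2 ≤ f) (hE : 2 * f - 3 ≤ E)
    {k t κ x y W Y : ℝ} (ht : 0 < t) (hk : 1 ≤ k) (hκ : 1 ≤ κ) (hy : 0 ≤ y)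
    (hW : 0 ≤ W) (hY : k ≤ Y) (hxy : x * y ≤ W * t) (hK : ValueBound f k t κ y)
    (hx : 1 ≤ 2 * (κ * x)) : 1 ≤ 2 * (κ ^ 2 * Y ^ E * W) := by
  have h2 := hK.nonlinear hf
  have hY1 : 1 ≤ Y := hk.trans hY
  have h3 : 1 * t ≤ (2 * (κ ^ 2 * k ^ (2 * f - 3) * W)) * t :=
    calc 1 * t = t * 1 := by ring
      _ ≤ (κ * k ^ (2 * f - 3) * y) * (2 * (κ * x)) :=
          mul_le_mul h2 hx zero_le_one (by positivity)
      _ = 2 * (κ ^ 2 * k ^ (2 * f - 3) * (x * y)) := by ring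
      _ ≤ 2 * (κ ^ 2 * k ^ (2 * f - 3) * (W * t)) := by gcongr
      _ = _ := by ring
  refine (le_of_mul_le_mul_right h3 ht).trans ?_
  calc 2 * (κ ^ 2 * k ^ (2 * f - 3) * W) ≤ 2 * (κ ^ 2 * Y ^ (2 * f - 3) * W) := by gcongr
    _ ≤ _ := by gcongr

/-- The exponent is dictated by the largest degree that one factor can have, which is the total
degree minus `m`. The alternatives `hxh`, `hyk` are used only when both factors are nonlinear, to
dispose of the `t` that remains. -/
theorem one_le_of_valueBounds {m e f : ℕ} (hm : m = 1 ∨ m = 2) (hme : m ≤ e) (hmf : m ≤ f)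
    {h k t κ x y W Y c : ℝ} (ht : 0 < t) (ht2 : t ≤ 2) (hh : 1 ≤ h) (hk : 1 ≤ k) (hκ : 2 ≤ κ)
    (hc : 2 ≤ c) (hx : 0 ≤ x) (hy : 0 ≤ y) (hW : 0 ≤ W) (hY : h * k ≤ Y) (hxy : x * y ≤ W * t)
    (hG : ValueBound e h t κ x) (hK : ValueBound f k t κ y)
    (hxh : 1 / 2 ≤ x ∨ 1 ≤ c * (h * t)) (hyk : 1 / 2 ≤ y ∨ 1 ≤ c * (k * t))
    (hs : m = 2 → e = 2 → f = 2 → t ≤ 2 * x) :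
    1 ≤ c * (κ ^ 2 * Y ^ (2 * (e + f - m) - 3) * W) := by
  set E := 2 * (e + f - m) - 3 with hE
  have hκ1 : 1 ≤ κ := by linarith
  have hc1 : 1 ≤ c := by linarith
  have hhY : h ≤ Y := by nlinarith
  have hkY : k ≤ Y := by nlinarith
  have hY1 : 1 ≤ Y := hh.trans hhY
  have hxy' : y * x ≤ W * t := by rwa [mul_comm]
  have hY' : k * h ≤ Y := by rwa [mul_comm]
  have two : 1 ≤ 2 * (κ ^ 2 * Y ^ E * W) → 1 ≤ c * (κ ^ 2 * Y ^ E * W) := fun h =>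
    h.trans (by gcongr)
  by_cases he1 : e = 1
  · have hx1 := hG.linear he1
    by_cases hf1 : f = 1
    · have hy1 := hK.linear hf1
      apply two
      calc (1 : ℝ) ≤ (κ * x) * (κ * y) := one_le_mul_of_one_le_of_one_le hx1 hy1
        _ = κ ^ 2 * (x * y) := by ring
        _ ≤ κ ^ 2 * (W * 2) := mul_le_mul_of_nonneg_left
            (hxy.trans (mul_le_mul_of_nonneg_left ht2 hW)) (by positivity)
        _ = 2 * (κ ^ 2 * 1 * W) := by ring
        _ ≤ _ := by gcongr; exact one_le_pow₀ hY1
    · exact two (one_le_of_valueBounds_of_half_le (by omega) (by omega) ht hk hκ1 hy hW hkY hxy hK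
        (by linarith))
  · by_cases hf1 : f = 1
    · have hy1 := hK.linear hf1
      exact two (one_le_of_valueBounds_of_half_le (by omega) (by omega) ht hh hκ1 hx hW hhY hxy' hG
        (by linarith))
    · have he2 : 2 ≤ e := by omega
      have hf2 : 2 ≤ f := by omega
      rcases hxh with hx2 | hht
      · exact two (one_le_of_valueBounds_of_half_le hf2 (by omega) ht hk hκ1 hy hW hkY hxy hK
          (by nlinarith))
      rcases hyk with hy2 | hkt
      · exact two (one_le_of_valueBounds_of_half_le he2 (by omega) ht hh hκ1 hx hW hhY hxy' hG
          (by nlinarith))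
      rcases lt_trichotomy f e with hlt | heq | hlt
      · exact one_le_of_valueBounds_of_lt he2 hf2 hlt (by omega) ht hh hk hκ1 hc1 hx hW hY hxy
          hG hK hkt
      · subst heq
        -- For equal degrees `f` the general argument costs exponent `2f - 2`. This fits unless `m =
        -- 2` and `f = 2`, where only exponent `1` is allowed and the bound `hs` is used instead.
        by_cases hsp : m = 2 ∧ f = 2
        · obtain ⟨rfl, rfl⟩ := hsp
          have h1 := hs rfl rfl rfl
          have h2 := hK.nonlinear le_rfl
          have h3 : t * t ≤ (κ ^ 2 * k * W) * t :=
            calc t * t ≤ (2 * x) * (κ * k ^ 1 * y) := mul_le_mul h1 h2 ht.le (by positivity)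
              _ = (2 * κ) * k * (x * y) := by ring
              _ ≤ (κ * κ) * k * (W * t) := by gcongr
              _ = _ := by ring
          have h4 := le_of_mul_le_mul_right h3 ht
          calc (1 : ℝ) ≤ c * (h * t) := hht
            _ ≤ c * (h * (κ ^ 2 * k * W)) := by gcongr
            _ = c * (κ ^ 2 * (h * k) ^ 1 * W) := by ring
            _ ≤ c * (κ ^ 2 * Y ^ 1 * W) := by gcongr
            _ = _ := rfl
        · have h1 := hG.nonlinear he2
          have h2 := hK.nonlinear hf2
          have h3 : t * t ≤ (κ ^ 2 * (h * k) ^ (2 * f - 3) * W) * t :=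
            calc t * t ≤ (κ * h ^ (2 * f - 3) * x) * (κ * k ^ (2 * f - 3) * y) :=
                  mul_le_mul h1 h2 ht.le (by positivity)
              _ = κ ^ 2 * (h ^ (2 * f - 3) * k ^ (2 * f - 3)) * (x * y) := by ring
              _ ≤ κ ^ 2 * (h ^ (2 * f - 3) * k ^ (2 * f - 3)) * (W * t) := by gcongr
              _ = _ := by rw [mul_pow]; ring
          have h4 := le_of_mul_le_mul_right h3 ht
          calc (1 : ℝ) ≤ c * (k * t) := hkt
            _ ≤ c * (Y * (κ ^ 2 * Y ^ (2 * f - 3) * W)) := by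
                gcongr
                exact h4.trans (by gcongr)
            _ = c * (κ ^ 2 * Y ^ (2 * f - 3 + 1) * W) := by ring
            _ ≤ _ := by
                gcongr
                rcases hm with rfl | rfl
                · omega
                · have : f ≠ 2 := fun h => hsp ⟨rfl, h⟩
                  omega
      · have := one_le_of_valueBounds_of_lt hf2 he2 hlt (E := E) (by omega) ht hk hh hκ1 hc1 hy
          hW hY' hxy' hK hG hht
        exact this

/-! ### Splittings and the factorizations of their outer coefficients. -/

/-- `M` is a product of two polynomials of degree at least `m`; for `m = 2` the outer coefficients
of the first one have to divide those of `P` and `Q`. -/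
def HasSplitting (P Q : ℤ[X]) (m : ℕ) (M : ℤ[X]) : Prop :=
  ∃ G K : ℤ[X], M = G * K ∧ m ≤ G.natDegree ∧ m ≤ K.natDegree ∧
    (m = 2 → G.leadingCoeff ∣ P.leadingCoeff ∧ G.coeff 0 ∣ Q.coeff 0)

/-- A factorization `M = G K` together with factorizations of the leading and the constant
coefficients that are compatible with `lc M = l₁ c` and `M(0) = l₂ d`. -/
structure SplitData (c d : ℤ) (m : ℕ) (l₁ l₂ : ℤ) (M : ℤ[X]) where
  (G K : ℤ[X])
  (a u a' u' b v b' v' : ℤ)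
  eq_mul : M = G * K
  le_left : m ≤ G.natDegree
  le_right : m ≤ K.natDegree
  lc_left : G.leadingCoeff = a * u
  lc_right : K.leadingCoeff = a' * u'
  mul_a : a * a' = c
  mul_u : u * u' = l₁
  const_left : G.coeff 0 = b * v
  const_right : K.coeff 0 = b' * v'
  mul_b : b * b' = d
  mul_v : v * v' = l₂
  special : m = 2 → u = 1 ∧ v = 1

theorem exists_compatible_factorization {g k c l : ℤ} (hc : c ≠ 0) (hl : l ≠ 0)
    (h : g * k = l * c) (s : Prop) (hs : s → g ∣ c) :
    ∃ a u a' u', g = a * u ∧ k = a' * u' ∧ a * a' = c ∧ u * u' = l ∧ (s → u = 1) := by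
  have hg : g ≠ 0 := left_ne_zero_of_mul (h ▸ mul_ne_zero hl hc)
  by_cases hS : s
  · obtain ⟨a', ha'⟩ := hs hS
    -- In the special case the whole of `l` goes to the cofactor, so members of a class have equal,
    -- not just proportional, outer coefficients.
    refine ⟨g, 1, a', l, by ring, ?_, ha'.symm, by ring, fun _ => rfl⟩
    apply mul_left_cancel₀ hg
    rw [h, ha']
    ring
  · obtain ⟨u, a, ⟨u', hu⟩, ⟨a', ha⟩, hg'⟩ := exists_dvd_and_dvd_of_dvd_mul (Dvd.intro k h)
    refine ⟨a, u, a', u', by rw [hg', mul_comm], ?_, ha.symm, hu.symm, fun hh => absurd hh hS⟩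
    apply mul_left_cancel₀ hg
    rw [h, hg', hu, ha]
    ring

theorem HasSplitting.nonempty_splitData {P Q M : ℤ[X]} {m : ℕ} (h : HasSplitting P Q m M)
    {l₁ l₂ : ℤ} (hc : P.leadingCoeff ≠ 0) (hd : Q.coeff 0 ≠ 0) (h1 : l₁ ≠ 0) (h2 : l₂ ≠ 0)
    (hM1 : M.leadingCoeff = l₁ * P.leadingCoeff) (hM2 : M.coeff 0 = l₂ * Q.coeff 0) :
    Nonempty (SplitData P.leadingCoeff (Q.coeff 0) m l₁ l₂ M) := by
  obtain ⟨G, K, hM, hG, hK, hs⟩ := h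
  rw [hM, leadingCoeff_mul] at hM1
  rw [hM, mul_coeff_zero] at hM2
  obtain ⟨a, u, a', u', e1, e2, e3, e4, e5⟩ :=
    exists_compatible_factorization hc h1 hM1 (m = 2) fun h => (hs h).1
  obtain ⟨b, v, b', v', f1, f2, f3, f4, f5⟩ :=
    exists_compatible_factorization hd h2 hM2 (m = 2) fun h => (hs h).2
  exact ⟨⟨G, K, a, u, a', u', b, v, b', v', hM, hG, hK, e1, e2, e3, e4, f1, f2, f3, f4,
    fun h => ⟨e5 h, f5 h⟩⟩⟩

/-! ### Combinations of an admissible pair. -/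

namespace AdmissiblePair

variable {n : ℕ} {H : ℝ} {P Q : ℤ[X]}

theorem left_ne_zero (h : AdmissiblePair n H P Q) : P ≠ 0 := by
  rintro rfl
  have := h.natDegree_right
  rw [← h.natDegree_left] at this
  simp at this

theorem isCoprime (h : AdmissiblePair n H P Q) : IsCoprime (toRat P) (toRat Q) :=
  h.noCommonFactor.isCoprime h.left_ne_zero

theorem leadingCoeff_ne_zero (h : AdmissiblePair n H P Q) : P.leadingCoeff ≠ 0 :=
  Polynomial.leadingCoeff_ne_zero.2 h.left_ne_zero

theorem coeff_zero_right_ne_zero (h : AdmissiblePair n H P Q) : Q.coeff 0 ≠ 0 := by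
  intro h0
  have := h.noCommonFactor X (X_dvd_iff.2 h.coeff_zero_left) (X_dvd_iff.2 h0)
  simp at this

theorem right_ne_zero (h : AdmissiblePair n H P Q) : Q ≠ 0 := by
  rintro rfl
  exact h.coeff_zero_right_ne_zero (by simp)

theorem one_le (h : AdmissiblePair n H P Q) : 1 ≤ H :=
  le_trans (by exact_mod_cast one_le_naiveHeight h.left_ne_zero) h.height_left

theorem abs_coeff_left_le (h : AdmissiblePair n H P Q) (i : ℕ) : |(P.coeff i : ℝ)| ≤ H :=
  (abs_coeff_le_naiveHeight P i).trans h.height_left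

theorem abs_coeff_right_le (h : AdmissiblePair n H P Q) (i : ℕ) : |(Q.coeff i : ℝ)| ≤ H :=
  (abs_coeff_le_naiveHeight Q i).trans h.height_right

theorem degree_polyM_lt (h : AdmissiblePair n H P Q) {l₁ : ℤ} (l₂ : ℤ) (h1 : l₁ ≠ 0) :
    (C l₂ * Q).degree < (C l₁ * P).degree := by
  rw [degree_C_mul h1]
  refine degree_lt_degree ((natDegree_C_mul_le _ _).trans_lt ?_)
  rw [h.natDegree_left]
  exact h.natDegree_right

theorem natDegree_polyM (h : AdmissiblePair n H P Q) {l₁ : ℤ} (l₂ : ℤ) (h1 : l₁ ≠ 0) :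
    (polyM P Q l₁ l₂).natDegree = n := by
  rw [polyM, natDegree_add_eq_left_of_degree_lt (h.degree_polyM_lt l₂ h1), natDegree_C_mul h1,
    h.natDegree_left]

theorem leadingCoeff_polyM (h : AdmissiblePair n H P Q) {l₁ : ℤ} (l₂ : ℤ) (h1 : l₁ ≠ 0) :
    (polyM P Q l₁ l₂).leadingCoeff = l₁ * P.leadingCoeff := by
  rw [polyM, leadingCoeff_add_of_degree_lt' (h.degree_polyM_lt l₂ h1), leadingCoeff_mul,
    leadingCoeff_C]

theorem coeff_zero_polyM (h : AdmissiblePair n H P Q) (l₁ l₂ : ℤ) :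
    (polyM P Q l₁ l₂).coeff 0 = l₂ * Q.coeff 0 := by
  simp [polyM, h.coeff_zero_left]

theorem polyM_ne_zero (h : AdmissiblePair n H P Q) {l₁ : ℤ} (l₂ : ℤ) (h1 : l₁ ≠ 0) :
    polyM P Q l₁ l₂ ≠ 0 :=
  Polynomial.leadingCoeff_ne_zero.1
    (by rw [h.leadingCoeff_polyM l₂ h1]; exact mul_ne_zero h1 h.leadingCoeff_ne_zero)

theorem naiveHeight_polyM_le (h : AdmissiblePair n H P Q) {l₁ l₂ : ℤ} {L : ℝ}
    (h1 : |(l₁ : ℝ)| ≤ L) (h2 : |(l₂ : ℝ)| ≤ L) : (naiveHeight (polyM P Q l₁ l₂) : ℝ) ≤ 2 * L * H := by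
  have hL : 0 ≤ L := (abs_nonneg _).trans h1
  have hH := h.one_le
  refine naiveHeight_le (by positivity) fun i => ?_
  have := abs_coeff_linearCombination_le (u := l₁) (v := -l₂) h1 (by simpa using h2)
    h.abs_coeff_left_le h.abs_coeff_right_le i
  simpa [polyM] using this

theorem isCoprime_polyM (h : AdmissiblePair n H P Q) {l₁ l₂ k₁ k₂ : ℤ}
    (hne : l₁ * k₂ - l₂ * k₁ ≠ 0) :
    IsCoprime (toRat (polyM P Q l₁ l₂)) (toRat (polyM P Q k₁ k₂)) :=
  isCoprime_toRat_combination h.isCoprime rfl rfl hne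

/-- The norm of `M` at a root `z` of `Q` that is close to a nonzero root of `P`. -/
theorem norm_aeval_polyM_le (h : AdmissiblePair n H P Q) {l₁ : ℤ} (l₂ : ℤ) {L : ℝ}
    (h1 : |(l₁ : ℝ)| ≤ L) {α β : ℂ} (hα : aeval α P = 0) (hα0 : α ≠ 0) (hβ : aeval β Q = 0)
    (hα3 : ‖α‖ ≤ 3) (hβ3 : ‖β‖ ≤ 3) {r : ℝ} (hr : ‖α - β‖ ≤ r) :
    ‖aeval β (polyM P Q l₁ l₂)‖ ≤ L * ((n + 1) * (n * 3 ^ n) * (H * r)) * ‖β‖ := by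
  have hL : 0 ≤ L := (abs_nonneg _).trans h1
  -- Estimating `P.divX` instead of `P` keeps the factor `‖β‖`, which is what later cancels against
  -- the lower bounds.
  have hPX : P = X * P.divX := by
    conv_lhs => rw [← divX_mul_X_add P, h.coeff_zero_left]
    simp [mul_comm]
  have hα' : aeval α P.divX = 0 := by
    rw [hPX, map_mul, aeval_X] at hα
    exact (mul_eq_zero.1 hα).resolve_left hα0
  have h2 := norm_aeval_sub_aeval_le (F := P.divX) (n := n)
    (by rw [natDegree_divX_eq_natDegree_tsub_one, h.natDegree_left]; omega) (h := H)
    (fun i => by rw [coeff_divX]; exact h.abs_coeff_left_le _) hβ3 hα3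
  rw [hα', sub_zero, norm_sub_rev] at h2
  have h3 : ‖aeval β P.divX‖ ≤ (n + 1) * (n * 3 ^ n) * (H * r) := by
    refine h2.trans ?_
    have := h.one_le
    gcongr
  have h4 : aeval β (polyM P Q l₁ l₂) = (l₁ : ℂ) * (β * aeval β P.divX) := by
    rw [polyM, map_add, map_mul, map_mul, hβ, mul_zero, add_zero, aeval_C, algebraMap_int_eq,
      eq_intCast]
    conv_lhs => rw [hPX, map_mul, aeval_X]
  rw [h4, norm_mul, norm_mul, Complex.norm_intCast]
  calc |(l₁ : ℝ)| * (‖β‖ * ‖aeval β P.divX‖)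
      ≤ L * (‖β‖ * ((n + 1) * (n * 3 ^ n) * (H * r))) := by gcongr
    _ = _ := by ring

end AdmissiblePair

/-! ### Comparing two splittings of the same class. -/

/-- The divisors of an integer, of both signs. -/
def signedDivisors (a : ℤ) : Finset ℤ :=
  (a.natAbs.divisors ×ˢ ({1, -1} : Finset ℤ)).image fun p => p.1 * p.2

theorem mem_signedDivisors {a x : ℤ} (ha : a ≠ 0) (hx : x ∣ a) : x ∈ signedDivisors a := by
  have h1 : x.natAbs ∈ a.natAbs.divisors :=
    Nat.mem_divisors.2 ⟨Int.natAbs_dvd_natAbs.2 hx, Int.natAbs_ne_zero.2 ha⟩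
  refine Finset.mem_image.2 ?_
  rcases Int.natAbs_eq x with h | h
  · exact ⟨(x.natAbs, 1), Finset.mem_product.2 ⟨h1, by simp⟩, by simpa using h.symm⟩
  · exact ⟨(x.natAbs, -1), Finset.mem_product.2 ⟨h1, by simp⟩, by simpa using h.symm⟩

theorem card_signedDivisors_le (a : ℤ) : (signedDivisors a).card ≤ 2 * tauInt a := by
  refine Finset.card_image_le.trans ?_
  rw [Finset.card_product, tauInt, mul_comm]
  exact Nat.mul_le_mul_right _ (by decide)

theorem ValueBound.mono {e : ℕ} {h t κ x y : ℝ} (hB : ValueBound e h t κ x) (hxy : x ≤ y)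
    (hκ : 0 ≤ κ) (hh : 0 ≤ h) : ValueBound e h t κ y :=
  ⟨fun he => (hB.linear he).trans (by gcongr), fun he => (hB.nonlinear he).trans (by gcongr)⟩

/-- The lower bounds for the first factor of a splitting: in the special case of two quadratic
factors they are stronger. -/
def LeftBound (m e f : ℕ) (h t κ x : ℝ) : Prop :=
  ValueBound e h t κ x ∧ (m = 2 → e = 2 → f = 2 → t ≤ 2 * x)

theorem abs_le_of_mul_eq {u u' : ℤ} {l : ℕ} (h : u * u' = l) (hl : 0 < l) {L : ℝ}
    (hL : (l : ℝ) ≤ L) : |(u : ℝ)| ≤ L ∧ |(u' : ℝ)| ≤ L := by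
  have key : ∀ x : ℤ, x ∣ (l : ℤ) → |(x : ℝ)| ≤ L := by
    intro x hx
    have h1 : |x| ≤ (l : ℤ) := by
      have := Int.le_of_dvd (by exact_mod_cast hl) ((abs_dvd x l).2 hx)
      exact this
    refine le_trans ?_ hL
    exact_mod_cast h1
  exact ⟨key u (Dvd.intro _ h), key u' (Dvd.intro_left _ h)⟩

namespace SplitData

variable {n m : ℕ} {H : ℝ} {P Q : ℤ[X]} {l₁ l₂ k₁ k₂ : ℕ}

theorem natDegree_add (D : SplitData P.leadingCoeff (Q.coeff 0) m l₁ l₂ (polyM P Q l₁ l₂))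
    (hPQ : AdmissiblePair n H P Q) (h1 : 0 < l₁) : D.G.natDegree + D.K.natDegree = n := by
  have h0 := hPQ.polyM_ne_zero l₂ (l₁ := l₁) (by exact_mod_cast h1.ne')
  rw [D.eq_mul] at h0
  rw [← natDegree_mul (left_ne_zero_of_mul h0) (right_ne_zero_of_mul h0), ← D.eq_mul,
    hPQ.natDegree_polyM l₂ (by exact_mod_cast h1.ne')]

theorem naiveHeight_mul_le (D : SplitData P.leadingCoeff (Q.coeff 0) m l₁ l₂ (polyM P Q l₁ l₂))
    (hPQ : AdmissiblePair n H P Q) (h1 : 0 < l₁) {L : ℝ} (hL1 : (l₁ : ℝ) ≤ L)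
    (hL2 : (l₂ : ℝ) ≤ L) :
    (naiveHeight D.G : ℝ) * naiveHeight D.K ≤ 2 ^ n * (n + 1) * (2 * L * H) := by
  have h1' : (l₁ : ℤ) ≠ 0 := by exact_mod_cast h1.ne'
  have h0 := hPQ.polyM_ne_zero l₂ h1'
  have hd := hPQ.natDegree_polyM l₂ h1'
  have hh := hPQ.naiveHeight_polyM_le (l₁ := l₁) (l₂ := l₂) (L := L) (by simpa using hL1)
    (by simpa using hL2)
  rw [D.eq_mul] at h0 hd hh
  refine (_root_.naiveHeight_mul_le h0 hd).trans ?_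
  gcongr

theorem b_ne_zero (D : SplitData P.leadingCoeff (Q.coeff 0) m l₁ l₂ (polyM P Q l₁ l₂))
    (hPQ : AdmissiblePair n H P Q) : D.b ≠ 0 ∧ D.b' ≠ 0 := by
  have := hPQ.coeff_zero_right_ne_zero
  rw [← D.mul_b] at this
  exact mul_ne_zero_iff.1 this

theorem v_ne_zero (D : SplitData P.leadingCoeff (Q.coeff 0) m l₁ l₂ (polyM P Q l₁ l₂))
    (h2 : 0 < l₂) : D.v ≠ 0 ∧ D.v' ≠ 0 := by
  have : (l₂ : ℤ) ≠ 0 := by exact_mod_cast h2.ne'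
  rw [← D.mul_v] at this
  exact mul_ne_zero_iff.1 this

theorem bounds_or_bounds (D : SplitData P.leadingCoeff (Q.coeff 0) m l₁ l₂ (polyM P Q l₁ l₂))
    (D' : SplitData P.leadingCoeff (Q.coeff 0) m k₁ k₂ (polyM P Q k₁ k₂))
    (hPQ : AdmissiblePair n H P Q) (hm : 1 ≤ m) (hl₁ : 0 < l₁) (hl₂ : 0 < l₂) (hk₁ : 0 < k₁)
    (hk₂ : 0 < k₂) (hne : (l₁ : ℤ) * k₂ - l₂ * k₁ ≠ 0) {L h k : ℝ} (hL : 1 ≤ L) (hh : 1 ≤ h)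
    (hk : 1 ≤ k) (hL1 : (l₁ : ℝ) ≤ L) (hL2 : (l₂ : ℝ) ≤ L) (hL3 : (k₁ : ℝ) ≤ L)
    (hL4 : (k₂ : ℝ) ≤ L) (ha : D.a = D'.a) (hb : D.b = D'.b)
    (hdeg : D.G.natDegree = D'.G.natDegree)
    (hG : (naiveHeight D.G : ℝ) ≤ h) (hG' : (naiveHeight D'.G : ℝ) ≤ h)
    (hK : (naiveHeight D.K : ℝ) ≤ k) (hK' : (naiveHeight D'.K : ℝ) ≤ k)
    {z : ℂ} (hz0 : z ≠ 0) (hz : ‖z‖ ≤ 2) :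
    (LeftBound m D.G.natDegree D.K.natDegree h ‖z‖ (pairConst n L) ‖aeval z D.G‖ ∨
      LeftBound m D'.G.natDegree D'.K.natDegree h ‖z‖ (pairConst n L) ‖aeval z D'.G‖) ∧
    (ValueBound D.K.natDegree k ‖z‖ (pairConst n L) ‖aeval z D.K‖ ∨
      ValueBound D'.K.natDegree k ‖z‖ (pairConst n L) ‖aeval z D'.K‖) := by
  have hκ : 0 ≤ pairConst n L := by linarith [four_mul_le_pairConst n hL]
  have hcop := hPQ.isCoprime_polyM hne
  rw [D.eq_mul, D'.eq_mul] at hcop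
  simp only [toRat, Polynomial.map_mul] at hcop
  have hcopG : IsCoprime (toRat D.G) (toRat D'.G) := hcop.of_mul_left_left.of_mul_right_left
  have hcopK : IsCoprime (toRat D.K) (toRat D'.K) := hcop.of_mul_left_right.of_mul_right_right
  have hs := D.natDegree_add hPQ hl₁
  have hs' := D'.natDegree_add hPQ hk₁
  have hmG := D.le_left
  have hmK := D.le_right
  have hdegK : D'.K.natDegree = D.K.natDegree := by omega
  obtain ⟨hu, hu'⟩ := abs_le_of_mul_eq D.mul_u hl₁ hL1
  obtain ⟨hv, hv'⟩ := abs_le_of_mul_eq D.mul_v hl₂ hL2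
  obtain ⟨hx, hx'⟩ := abs_le_of_mul_eq D'.mul_u hk₁ hL3
  obtain ⟨hy, hy'⟩ := abs_le_of_mul_eq D'.mul_v hk₂ hL4
  have ha0 : D.a ≠ 0 := by
    have := hPQ.leadingCoeff_ne_zero
    rw [← D.mul_a] at this
    exact left_ne_zero_of_mul this
  obtain ⟨hb0, hb0'⟩ := D.b_ne_zero hPQ
  -- The cofactors automatically share their invariants, since `a * a'` and `b * b'` are fixed.
  have ha' : D'.a' = D.a' := by
    apply mul_left_cancel₀ ha0
    rw [D.mul_a, ha, D'.mul_a]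
  have hb' : D'.b' = D.b' := by
    apply mul_left_cancel₀ hb0
    rw [D.mul_b, hb, D'.mul_b]
  have hci : ∀ {F : ℤ[X]} {B : ℝ}, (naiveHeight F : ℝ) ≤ B → ∀ i, |(F.coeff i : ℝ)| ≤ B :=
    fun hF i => (abs_coeff_le_naiveHeight _ i).trans hF
  constructor
  · have key := valueBound_or_valueBound (hm.trans hmG) (by omega : D.G.natDegree ≤ n)
      rfl hdeg.symm hcopG D.lc_left
      (by rw [D'.lc_left, ha]) D.const_left (by rw [D'.const_left, hb]) hb0 (D.v_ne_zero hl₂).1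
      hL hh hu hx hv hy (hci hG) (hci hG') hz0 hz
    have key2 : m = 2 → D.G.natDegree = 2 → ‖z‖ ≤ 2 * ‖aeval z D.G‖ ∨
        ‖z‖ ≤ 2 * ‖aeval z D'.G‖ := by
      intro hm2 h2
      refine norm_le_or_norm_le_of_quadratic h2 (hdeg ▸ h2) hcopG ?_ ?_ z
      · rw [D.lc_left, D'.lc_left, ha, (D.special hm2).1, (D'.special hm2).1]
      · rw [D.const_left, D'.const_left, hb, (D.special hm2).2, (D'.special hm2).2]
    rw [← hdeg, hdegK]
    -- The general and the quadratic bound must hold for the same polynomial; the one with the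
    -- larger value at `z` satisfies both.
    rcases le_total ‖aeval z D.G‖ ‖aeval z D'.G‖ with hle | hle
    · refine Or.inr ⟨key.elim (fun h => h.mono hle hκ (by linarith)) id, fun h1 h2 _ => ?_⟩
      rcases key2 h1 h2 with h | h <;> linarith
    · refine Or.inl ⟨key.elim id (fun h => h.mono hle hκ (by linarith)), fun h1 h2 _ => ?_⟩
      rcases key2 h1 h2 with h | h <;> linarith
  · have key := valueBound_or_valueBound (hm.trans hmK) (by omega : D.K.natDegree ≤ n)
      rfl hdegK hcopK D.lc_right
      (by rw [D'.lc_right, ha']) D.const_right (by rw [D'.const_right, hb']) hb0'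
      (D.v_ne_zero hl₂).2 hL hk hu' hx' hv' hy' (hci hK) (hci hK') hz0 hz
    rw [hdegK]
    exact key

/-- The constant coefficient is a nonzero integer, so a value below `1 / 2` forces `z` to be at
distance at least about `1 / h` from the origin. -/
theorem half_le_or (n : ℕ) {F : ℤ[X]} (hF : F.natDegree ≤ n) (h0 : F.coeff 0 ≠ 0) {h : ℝ}
    (hh : (naiveHeight F : ℝ) ≤ h) {z : ℂ} (hz : ‖z‖ ≤ 2) :
    1 / 2 ≤ ‖aeval z F‖ ∨ 1 ≤ 2 * ((n + 1) * (n * 3 ^ n)) * (h * ‖z‖) := by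
  have h1 := norm_aeval_sub_aeval_le hF
    (fun i => (abs_coeff_le_naiveHeight F i).trans hh) (z := z) (w := 0) (by linarith) (by simp)
  rw [sub_zero] at h1
  have h2 : 1 ≤ ‖aeval (0 : ℂ) F‖ := by
    have : aeval (0 : ℂ) F = (F.coeff 0 : ℂ) := by
      rw [← coeff_zero_eq_aeval_zero']
      simp
    rw [this]
    exact one_le_norm_intCast h0
  have h3 := norm_sub_norm_le (aeval (0 : ℂ) F) (aeval z F)
  rw [norm_sub_rev] at h3
  by_contra hcon
  push Not at hcon
  linarith [hcon.1, hcon.2]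

end SplitData

/-! ### The smallness condition and the pigeonhole argument. -/

/-- The constant `2 (n + 1) n 3 ^ n` of Lipschitz bounds on the disc of radius `3`. -/
noncomputable def lipConst (n : ℕ) : ℝ := 2 * ((n + 1) * (n * 3 ^ n))

theorem two_le_lipConst {n : ℕ} (hn : 1 ≤ n) : 2 ≤ lipConst n := by
  have h1 : (1 : ℝ) ≤ n := by exact_mod_cast hn
  have h2 : (1 : ℝ) ≤ 3 ^ n := one_le_pow₀ (by norm_num)
  have := one_le_mul_of_one_le_of_one_le (by linarith : (1 : ℝ) ≤ n + 1)
    (one_le_mul_of_one_le_of_one_le h1 h2)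
  unfold lipConst
  linarith

/-- The bound for the product of the heights of the factors of `M`. -/
noncomputable def heightConst (n : ℕ) (L H : ℝ) : ℝ := 2 ^ n * (n + 1) * (4 * L * H)

/-- The quantity whose smallness makes the close roots argument work. -/
noncomputable def smallness (n m : ℕ) (L H r : ℝ) : ℝ :=
  lipConst n * (pairConst n L ^ 2 * heightConst n L H ^ (2 * (n - m) - 3) *
    (L * (lipConst n * (H * r))))

/-- All other factors of `smallness` are at least `1`. Thus the one hypothesis `smallness < 1` also
shows that the close roots are nonzero. -/
theorem le_smallness {n m : ℕ} (hn : 1 ≤ n) {L H r : ℝ} (hL : 1 ≤ L) (hH : 1 ≤ H) (hr : 0 ≤ r) :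
    lipConst n * (H * r) ≤ smallness n m L H r := by
  have h1 := two_le_lipConst hn
  have h2 := four_mul_le_pairConst n hL
  have h3 : 1 ≤ heightConst n L H := by
    unfold heightConst
    have e1 : (1 : ℝ) ≤ 2 ^ n := one_le_pow₀ (by norm_num)
    have e2 : (1 : ℝ) ≤ n + 1 := by simp
    have e3 : 1 ≤ 4 * L * H := by nlinarith
    exact one_le_mul_of_one_le_of_one_le (one_le_mul_of_one_le_of_one_le e1 e2) e3
  have h4 : 0 ≤ lipConst n * (H * r) := by positivity
  have h5 : 1 ≤ lipConst n * (pairConst n L ^ 2 * heightConst n L H ^ (2 * (n - m) - 3) * L) :=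
    one_le_mul_of_one_le_of_one_le (by linarith)
      (one_le_mul_of_one_le_of_one_le (one_le_mul_of_one_le_of_one_le
        (one_le_pow₀ (by linarith)) (one_le_pow₀ h3)) hL)
  calc lipConst n * (H * r)
      ≤ (lipConst n * (pairConst n L ^ 2 * heightConst n L H ^ (2 * (n - m) - 3) * L)) *
        (lipConst n * (H * r)) := le_mul_of_one_le_left h4 h5
    _ = _ := by unfold smallness; ring

/-- `|Q(0)| ≥ 1`, while `Q` vanishes at `β` and is smaller than `1` at the nearby point `α`. -/
theorem AdmissiblePair.root_ne_zero {n : ℕ} {H : ℝ} {P Q : ℤ[X]} (hPQ : AdmissiblePair n H P Q)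
    {β : ℂ} (hβ : aeval β Q = 0) {α : ℂ} {r : ℝ} (hα3 : ‖α‖ ≤ 3) (hβ3 : ‖β‖ ≤ 3)
    (hr : ‖α - β‖ ≤ r) (hsm : lipConst n * (H * r) < 1) : α ≠ 0 ∧ β ≠ 0 := by
  have h0 : ∀ z : ℂ, z = 0 → 1 ≤ ‖aeval z Q‖ := by
    rintro z rfl
    rw [← coeff_zero_eq_aeval_zero', algebraMap_int_eq, eq_intCast]
    exact one_le_norm_intCast hPQ.coeff_zero_right_ne_zero
  have hH := hPQ.one_le
  refine ⟨fun h => ?_, fun h => ?_⟩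
  · have h1 := norm_aeval_sub_aeval_le hPQ.natDegree_right.le hPQ.abs_coeff_right_le hα3 hβ3
    rw [hβ, sub_zero] at h1
    have h2 := h0 α h
    have h3 : ((n : ℝ) + 1) * (n * 3 ^ n) * (H * ‖α - β‖) ≤ (n + 1) * (n * 3 ^ n) * (H * r) := by
      gcongr
    unfold lipConst at hsm
    linarith
  · have := h0 β h
    rw [hβ, norm_zero] at this
    linarith

theorem AdmissiblePair.not_bounds {n m : ℕ} {H : ℝ} {P Q : ℤ[X]} (hPQ : AdmissiblePair n H P Q)
    (hm : m = 1 ∨ m = 2) {L r : ℝ} (hL : 1 ≤ L) {α β : ℂ}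
    (hα : aeval α P = 0) (hβ : aeval β Q = 0) (hβ2 : ‖β‖ ≤ 2) (hr : ‖α - β‖ ≤ r) (hr1 : r ≤ 1)
    (hsm : smallness n m L H r < 1) {l₁ l₂ : ℕ} (hl₁ : 0 < l₁) (hl₂ : 0 < l₂)
    (hL1 : (l₁ : ℝ) ≤ L)
    (D : SplitData P.leadingCoeff (Q.coeff 0) m l₁ l₂ (polyM P Q l₁ l₂)) {h : ℝ} (hh : 1 ≤ h)
    (hk : 1 ≤ heightConst n L H / h) (hG : (naiveHeight D.G : ℝ) ≤ h)
    (hK : (naiveHeight D.K : ℝ) ≤ heightConst n L H / h)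
    (hbG : LeftBound m D.G.natDegree D.K.natDegree h ‖β‖ (pairConst n L) ‖aeval β D.G‖)
    (hbK : ValueBound D.K.natDegree (heightConst n L H / h) ‖β‖ (pairConst n L) ‖aeval β D.K‖) :
    False := by
  have hH := hPQ.one_le
  have hr0 : 0 ≤ r := (norm_nonneg _).trans hr
  have hsum := D.natDegree_add hPQ hl₁
  have hmG := D.le_left
  have hmK := D.le_right
  have hn : 1 ≤ n := by omega
  have hsm' := (le_smallness (m := m) hn hL hH hr0).trans_lt hsm
  -- This is why the Lipschitz bounds are set on the disc of radius `3`: `‖β‖ ≤ 2` and `r ≤ 1`.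
  have hα3 : ‖α‖ ≤ 3 := by
    have := norm_add_le (α - β) β
    rw [sub_add_cancel] at this
    linarith
  obtain ⟨hα0, hβ0⟩ := hPQ.root_ne_zero hβ hα3 (hβ2.trans (by norm_num)) hr hsm'
  have hM := hPQ.norm_aeval_polyM_le (l₁ := l₁) l₂ (L := L) (by simpa using hL1) hα hα0 hβ hα3
    (hβ2.trans (by norm_num)) hr
  rw [D.eq_mul, map_mul, norm_mul] at hM
  have hc0 : D.G.coeff 0 ≠ 0 ∧ D.K.coeff 0 ≠ 0 := by
    rw [D.const_left, D.const_right]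
    exact ⟨mul_ne_zero (D.b_ne_zero hPQ).1 (D.v_ne_zero hl₂).1,
      mul_ne_zero (D.b_ne_zero hPQ).2 (D.v_ne_zero hl₂).2⟩
  have hlip := two_le_lipConst hn
  have hW : 0 ≤ L * (lipConst n * (H * r)) := by positivity
  have hfin := one_le_of_valueBounds hm hmG hmK (norm_pos_iff.2 hβ0) hβ2 hh hk
    (by linarith [four_mul_le_pairConst n hL]) hlip (norm_nonneg _) (norm_nonneg _) hW
    (Y := heightConst n L H) (le_of_eq (by field_simp)) (hM.trans ?_) hbG.1 hbK
    (SplitData.half_le_or n (by omega) hc0.1 hG hβ2)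
    (SplitData.half_le_or n (by omega) hc0.2 hK hβ2) hbG.2
  · rw [hsum] at hfin
    exact absurd hsm (not_lt.2 hfin)
  · have e : (0 : ℝ) ≤ (n + 1) * (n * 3 ^ n) := by positivity
    gcongr
    unfold lipConst
    linarith

/-- Among three indices, if at most one violates a property `G` and at most one violates a property
`K`, then one has both. -/
theorem exists_both {G₁ G₂ G₃ K₁ K₂ K₃ : Prop} (h12 : (G₁ ∨ G₂) ∧ (K₁ ∨ K₂))
    (h13 : (G₁ ∨ G₃) ∧ (K₁ ∨ K₃)) (h23 : (G₂ ∨ G₃) ∧ (K₂ ∨ K₃)) (h1 : G₁ → K₁ → False)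
    (h2 : G₂ → K₂ → False) (h3 : G₃ → K₃ → False) : False := by
  tauto

/-- The number of classes into which splittings are divided. -/
noncomputable def classCount (n : ℕ) (c d : ℤ) (L H : ℝ) : ℕ :=
  (2 * tauInt c) * ((2 * tauInt d) * ((n + 1) * (Nat.log 2 ⌊heightConst n L H⌋₊ + 1)))

/-- Each class of splittings contains at most two members, by the argument with three indices in
`exists_both`. -/
theorem AdmissiblePair.card_le_of_norm_le_two {n m : ℕ} {H : ℝ} {P Q : ℤ[X]}
    (hPQ : AdmissiblePair n H P Q) (hm : m = 1 ∨ m = 2) {L r : ℝ} (hL : 1 ≤ L) {α β : ℂ}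
    (hα : aeval α P = 0) (hβ : aeval β Q = 0) (hβ2 : ‖β‖ ≤ 2) (hr : ‖α - β‖ ≤ r) (hr1 : r ≤ 1)
    (hsm : smallness n m L H r < 1) (T : Finset (ℕ × ℕ))
    (hT : ∀ p ∈ T, 0 < p.1 ∧ 0 < p.2 ∧ p.1.Coprime p.2 ∧ (p.1 : ℝ) ≤ L ∧ (p.2 : ℝ) ≤ L ∧
      HasSplitting P Q m (polyM P Q p.1 p.2)) :
    T.card ≤ 2 * classCount n P.leadingCoeff (Q.coeff 0) L H := by
  classical
  have hH := hPQ.one_le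
  have hdata : ∀ p : T, Nonempty (SplitData P.leadingCoeff (Q.coeff 0) m (p.1.1 : ℕ) (p.1.2 : ℕ)
      (polyM P Q (p.1.1 : ℕ) (p.1.2 : ℕ))) := by
    rintro ⟨p, hp⟩
    obtain ⟨h1, h2, -, -, -, h6⟩ := hT p hp
    have h1' : (p.1 : ℤ) ≠ 0 := by exact_mod_cast h1.ne'
    have h2' : (p.2 : ℤ) ≠ 0 := by exact_mod_cast h2.ne'
    exact h6.nonempty_splitData hPQ.leadingCoeff_ne_zero hPQ.coeff_zero_right_ne_zero h1' h2'
      (hPQ.leadingCoeff_polyM _ h1') (hPQ.coeff_zero_polyM _ _)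
  let D := fun p : T => (hdata p).some
  let key : T → ℤ × ℤ × ℕ × ℕ := fun p =>
    ((D p).a, (D p).b, (D p).G.natDegree, Nat.log 2 (naiveHeight (D p).G))
  let keys : Finset (ℤ × ℤ × ℕ × ℕ) := signedDivisors P.leadingCoeff ×ˢ
    signedDivisors (Q.coeff 0) ×ˢ Finset.range (n + 1) ×ˢ
      Finset.range (Nat.log 2 ⌊heightConst n L H⌋₊ + 1)
  have hGK0 : ∀ p : T, (D p).G ≠ 0 ∧ (D p).K ≠ 0 := by
    intro p
    have h0 := hPQ.polyM_ne_zero (l₁ := (p.1.1 : ℕ)) (p.1.2 : ℕ)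
      (by exact_mod_cast (hT p.1 p.2).1.ne')
    rw [(D p).eq_mul] at h0
    exact mul_ne_zero_iff.1 h0
  -- The spare factor `2` in `heightConst` pays for rounding the height of `G` up to a power of two.
  have hGK : ∀ p : T, 2 * ((naiveHeight (D p).G : ℝ) * naiveHeight (D p).K) ≤
      heightConst n L H := by
    intro p
    obtain ⟨h1, h2, -, h4, h5, h6⟩ := hT p.1 p.2
    have := (D p).naiveHeight_mul_le hPQ h1 h4 h5
    unfold heightConst
    linarith
  have hmaps : ∀ p ∈ (Finset.univ : Finset T), key p ∈ keys := by
    intro p _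
    obtain ⟨h1, h2, -, h4, h5, h6⟩ := hT p.1 p.2
    refine Finset.mem_product.2 ⟨mem_signedDivisors hPQ.leadingCoeff_ne_zero
      (Dvd.intro _ (D p).mul_a), Finset.mem_product.2 ⟨mem_signedDivisors
        hPQ.coeff_zero_right_ne_zero (Dvd.intro _ (D p).mul_b), Finset.mem_product.2 ⟨?_, ?_⟩⟩⟩
    · have := (D p).natDegree_add hPQ h1
      exact Finset.mem_range.2 (by change (D p).G.natDegree < n + 1; omega)
    · refine Finset.mem_range.2 (Nat.lt_succ_of_le (show Nat.log 2 (naiveHeight (D p).G) ≤ _ from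
        Nat.log_mono_right (Nat.le_floor ?_)))
      have h7 : (1 : ℝ) ≤ naiveHeight (D p).K := by
        exact_mod_cast one_le_naiveHeight (hGK0 p).2
      have h8 : (0 : ℝ) ≤ naiveHeight (D p).G := by positivity
      nlinarith [hGK p]
  have hfib : ∀ κ ∈ keys, ((Finset.univ : Finset T).filter fun p => key p = κ).card ≤ 2 := by
    intro κ _
    by_contra hcon
    push Not at hcon
    obtain ⟨p, q, s, hp, hq, hs, hpq, hps, hqs⟩ := Finset.two_lt_card_iff.1 hcon
    simp only [Finset.mem_filter, Finset.mem_univ, true_and] at hp hq hs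
    set j := κ.2.2.2 with hj
    have hG : ∀ x : T, key x = κ → (naiveHeight (D x).G : ℝ) ≤ 2 ^ (j + 1) := by
      intro x hx
      have : Nat.log 2 (naiveHeight (D x).G) = j := by rw [hj, ← hx]
      rw [← this]
      exact_mod_cast (Nat.lt_pow_succ_log_self (by norm_num) _).le
    have hK : ∀ x : T, key x = κ →
        (naiveHeight (D x).K : ℝ) ≤ heightConst n L H / 2 ^ (j + 1) := by
      intro x hx
      have hlog : Nat.log 2 (naiveHeight (D x).G) = j := by rw [hj, ← hx]
      have h1 : (2 : ℝ) ^ j ≤ naiveHeight (D x).G := by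
        rw [← hlog]
        have := Nat.pow_log_le_self 2
          (Nat.one_le_iff_ne_zero.1 (one_le_naiveHeight (hGK0 x).1))
        exact_mod_cast this
      rw [le_div_iff₀ (by positivity)]
      calc (naiveHeight (D x).K : ℝ) * 2 ^ (j + 1) = 2 * (2 ^ j * naiveHeight (D x).K) := by ring
        _ ≤ 2 * (naiveHeight (D x).G * naiveHeight (D x).K) := by gcongr
        _ ≤ _ := hGK x
    have hk1 : 1 ≤ heightConst n L H / 2 ^ (j + 1) := by
      refine le_trans ?_ (hK p hp)
      exact_mod_cast one_le_naiveHeight (hGK0 p).2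
    have hh1 : (1 : ℝ) ≤ 2 ^ (j + 1) := one_le_pow₀ (by norm_num)
    have hfalse : ∀ x : T, key x = κ →
        LeftBound m (D x).G.natDegree (D x).K.natDegree (2 ^ (j + 1)) ‖β‖ (pairConst n L)
          ‖aeval β (D x).G‖ →
        ValueBound (D x).K.natDegree (heightConst n L H / 2 ^ (j + 1)) ‖β‖ (pairConst n L)
          ‖aeval β (D x).K‖ → False := by
      intro x hx
      obtain ⟨h1, h2, -, h4, h5, h6⟩ := hT x.1 x.2
      exact hPQ.not_bounds hm hL hα hβ hβ2 hr hr1 hsm h1 h2 h4 (D x) hh1 hk1 (hG x hx) (hK x hx)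
    have hβ0 : β ≠ 0 := by
      rintro rfl
      apply hPQ.coeff_zero_right_ne_zero
      rw [← coeff_zero_eq_aeval_zero', algebraMap_int_eq, eq_intCast] at hβ
      exact_mod_cast hβ
    have hpair : ∀ x y : T, x ≠ y → key x = κ → key y = κ → _ := fun x y hxy hx hy => by
      obtain ⟨h1, h2, h3, h4, h5, h6⟩ := hT x.1 x.2
      obtain ⟨i1, i2, i3, i4, i5, i6⟩ := hT y.1 y.2
      -- Distinct pairs of coprime positive integers are not proportional; coprimality of the
      -- parameters is used only here.
      have hne : (x.1.1 : ℤ) * (y.1.2 : ℕ) - (x.1.2 : ℕ) * (y.1.1 : ℕ) ≠ 0 := by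
        intro h0
        apply hxy
        have h0' : x.1.1 * y.1.2 = x.1.2 * y.1.1 := by
          have := sub_eq_zero.1 h0
          exact_mod_cast this
        have e1 : x.1.1 ∣ y.1.1 := h3.dvd_of_dvd_mul_left (Dvd.intro _ h0')
        have e2 : y.1.1 ∣ x.1.1 := i3.dvd_of_dvd_mul_right (Dvd.intro_left _ h0'.symm)
        have e3 := Nat.dvd_antisymm e1 e2
        have e4 : x.1.2 = y.1.2 := by
          rw [e3, mul_comm] at h0'
          exact (Nat.eq_of_mul_eq_mul_right i1 h0').symm
        exact Subtype.ext (Prod.ext e3 e4)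
      have hxy' := hx.trans hy.symm
      exact (D x).bounds_or_bounds (D y) hPQ (by omega) h1 h2 i1 i2 hne hL hh1 hk1 h4 h5 i4 i5
        (congrArg (fun k => k.1) hxy') (congrArg (fun k => k.2.1) hxy')
        (congrArg (fun k => k.2.2.1) hxy') (hG x hx) (hG y hy) (hK x hx) (hK y hy) hβ0 hβ2
    have a1 := hpair p q hpq hp hq
    have a2 := hpair p s hps hp hs
    have a3 := hpair q s hqs hq hs
    exact exists_both a1 a2 a3 (hfalse p hp) (hfalse q hq) (hfalse s hs)
  have hcard := Finset.card_le_mul_card_image_of_maps_to hmaps 2 hfib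
  rw [Finset.card_univ, Fintype.card_coe] at hcard
  refine hcard.trans (Nat.mul_le_mul_left _ ?_)
  simp only [keys, Finset.card_product, Finset.card_range]
  unfold classCount
  exact Nat.mul_le_mul (card_signedDivisors_le _) (Nat.mul_le_mul (card_signedDivisors_le _) le_rfl)

/-! ### Reciprocal polynomials. -/

theorem natDegree_reflect {N : ℕ} {F : ℤ[X]} (hF : F.natDegree ≤ N) (h0 : F.coeff 0 ≠ 0) :
    (F.reflect N).natDegree = N := by
  refine le_antisymm ((natDegree_reflect_le).trans (max_le le_rfl hF)) (le_natDegree_of_ne_zero ?_)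
  rw [coeff_reflect, revAt_le le_rfl, Nat.sub_self]
  exact h0

theorem leadingCoeff_reflect {N : ℕ} {F : ℤ[X]} (hF : F.natDegree ≤ N) (h0 : F.coeff 0 ≠ 0) :
    (F.reflect N).leadingCoeff = F.coeff 0 := by
  rw [leadingCoeff, natDegree_reflect hF h0, coeff_reflect, revAt_le le_rfl, Nat.sub_self]

theorem coeff_zero_reflect (N : ℕ) (F : ℤ[X]) : (F.reflect N).coeff 0 = F.coeff N := by
  rw [coeff_reflect, revAt_zero]

theorem polyM_reflect (n : ℕ) (P Q : ℤ[X]) (l₁ l₂ : ℤ) :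
    polyM (Q.reflect n) (P.reflect n) l₁ l₂ = (polyM P Q l₂ l₁).reflect n := by
  rw [polyM, polyM, reflect_add, reflect_C_mul, reflect_C_mul, add_comm]

theorem reflect_dvd {n : ℕ} {G F : ℤ[X]} (hF0 : F ≠ 0) (hF : F.natDegree ≤ n) (h : G ∣ F.reflect n) :
    G.reflect G.natDegree ∣ F := by
  obtain ⟨K, hK⟩ := h
  have h0 : G * K ≠ 0 := by
    rw [← hK]
    exact mt reflect_eq_zero_iff.1 hF0
  have hdeg : G.natDegree + K.natDegree ≤ n := by
    rw [← natDegree_mul (left_ne_zero_of_mul h0) (right_ne_zero_of_mul h0), ← hK]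
    exact natDegree_reflect_le.trans (max_le le_rfl hF)
  have h1 := reflect_mul G K le_rfl (by omega : K.natDegree ≤ n - G.natDegree)
  rw [Nat.add_sub_cancel' (by omega), ← hK, reflect_reflect] at h1
  exact Dvd.intro _ h1.symm

theorem aeval_inv_reflect {n : ℕ} {F : ℤ[X]} (hF : F.natDegree ≤ n) {z : ℂ} (hz : z ≠ 0)
    (h : aeval z F = 0) : aeval z⁻¹ (F.reflect n) = 0 := by
  let := invertibleOfNonzero hz
  have := (eval₂_reflect_eq_zero_iff (algebraMap ℤ ℂ) z n F hF).2 h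
  rwa [invOf_eq_inv] at this

theorem naiveHeight_reflect_le (n : ℕ) (F : ℤ[X]) :
    (naiveHeight (F.reflect n) : ℝ) ≤ naiveHeight F :=
  naiveHeight_le (by positivity) fun i => by
    rw [coeff_reflect]
    exact abs_coeff_le_naiveHeight _ _

/-- Reversal at degree `n` interchanges the roles of `P` and `Q`: the conditions `P(0) = 0` and `deg
Q < n` are exchanged, as are `c_n` and `d₀`. -/
theorem AdmissiblePair.reflect {n : ℕ} {H : ℝ} {P Q : ℤ[X]} (h : AdmissiblePair n H P Q) :
    AdmissiblePair n H (Q.reflect n) (P.reflect n) where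
  natDegree_left := natDegree_reflect h.natDegree_right.le h.coeff_zero_right_ne_zero
  coeff_zero_left := by
    rw [coeff_zero_reflect, coeff_eq_zero_of_natDegree_lt h.natDegree_right]
  natDegree_right := by
    have hle : (P.reflect n).natDegree ≤ n :=
      natDegree_reflect_le.trans (max_le le_rfl h.natDegree_left.le)
    refine lt_of_le_of_ne hle fun heq => ?_
    have h0 : (P.reflect n).leadingCoeff = 0 := by
      rw [leadingCoeff, heq, coeff_reflect, revAt_le le_rfl, Nat.sub_self, h.coeff_zero_left]
    rw [leadingCoeff_eq_zero, reflect_eq_zero_iff] at h0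
    exact h.left_ne_zero h0
  noCommonFactor := by
    intro G hGQ hGP
    have h0 : G.coeff 0 ≠ 0 := by
      obtain ⟨K, hK⟩ := hGP
      have h1 := h.leadingCoeff_ne_zero
      rw [leadingCoeff, h.natDegree_left, ← coeff_zero_reflect, hK, mul_coeff_zero] at h1
      exact left_ne_zero_of_mul h1
    have := h.noCommonFactor _ (reflect_dvd h.left_ne_zero h.natDegree_left.le hGP)
      (reflect_dvd h.right_ne_zero h.natDegree_right.le hGQ)
    rwa [natDegree_reflect le_rfl h0] at this
  height_left := (naiveHeight_reflect_le n Q).trans h.height_right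
  height_right := (naiveHeight_reflect_le n P).trans h.height_left

theorem AdmissiblePair.leadingCoeff_reflect {n : ℕ} {H : ℝ} {P Q : ℤ[X]}
    (h : AdmissiblePair n H P Q) : (Q.reflect n).leadingCoeff = Q.coeff 0 :=
  _root_.leadingCoeff_reflect h.natDegree_right.le h.coeff_zero_right_ne_zero

theorem AdmissiblePair.coeff_zero_reflect {n : ℕ} {H : ℝ} {P Q : ℤ[X]}
    (h : AdmissiblePair n H P Q) : (P.reflect n).coeff 0 = P.leadingCoeff := by
  rw [_root_.coeff_zero_reflect, leadingCoeff, h.natDegree_left]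

theorem exists_reflect_mul {n : ℕ} {M G K : ℤ[X]} (hM : M.natDegree = n) (h0 : M.coeff 0 ≠ 0)
    (h : M = G * K) : G.coeff 0 ≠ 0 ∧ K.coeff 0 ≠ 0 ∧
      M.reflect n = G.reflect G.natDegree * K.reflect K.natDegree := by
  have hM0 : M ≠ 0 := by
    rintro rfl
    simp at h0
  rw [h] at hM0
  rw [h, natDegree_mul (left_ne_zero_of_mul hM0) (right_ne_zero_of_mul hM0)] at hM
  rw [h, mul_coeff_zero] at h0
  refine ⟨left_ne_zero_of_mul h0, right_ne_zero_of_mul h0, ?_⟩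
  rw [h, ← hM, reflect_mul G K le_rfl le_rfl]

theorem HasSplitting.reflect {n m : ℕ} {H : ℝ} {P Q M : ℤ[X]} (hPQ : AdmissiblePair n H P Q)
    (hM : M.natDegree = n) (h0 : M.coeff 0 ≠ 0) (h : HasSplitting P Q m M) :
    HasSplitting (Q.reflect n) (P.reflect n) m (M.reflect n) := by
  obtain ⟨G, K, hGK, hG, hK, hs⟩ := h
  obtain ⟨hG0, hK0, hR⟩ := exists_reflect_mul hM h0 hGK
  refine ⟨_, _, hR, ?_, ?_, fun hm => ?_⟩
  · rwa [natDegree_reflect le_rfl hG0]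
  · rwa [natDegree_reflect le_rfl hK0]
  · rw [leadingCoeff_reflect le_rfl hG0, hPQ.leadingCoeff_reflect, hPQ.coeff_zero_reflect,
      coeff_zero_reflect]
    exact (hs hm).symm

theorem IsReduciblePoly.reflect {n : ℕ} {M : ℤ[X]} (hM : M.natDegree = n) (h0 : M.coeff 0 ≠ 0)
    (h : IsReduciblePoly M) : IsReduciblePoly (M.reflect n) := by
  obtain ⟨G, ⟨K, hGK⟩, hG, hGM⟩ := h
  obtain ⟨hG0, -, hR⟩ := exists_reflect_mul hM h0 hGK
  refine ⟨_, Dvd.intro _ hR.symm, ?_, ?_⟩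
  · rwa [natDegree_reflect le_rfl hG0]
  · rwa [natDegree_reflect le_rfl hG0, natDegree_reflect hM.le h0, ← hM]

/-- If `P` and `Q` have close roots, then few of the polynomials `l₁ P + l₂ Q` split. -/
theorem AdmissiblePair.card_le {n m : ℕ} {H : ℝ} {P Q : ℤ[X]}
    (hPQ : AdmissiblePair n H P Q) (hm : m = 1 ∨ m = 2) {L r : ℝ} (hL : 1 ≤ L)
    (hroots : HaveCloseRoots P Q r) (hr1 : r ≤ 1)
    (hsm : smallness n m L H r < 1) (T : Finset (ℕ × ℕ))
    (hT : ∀ p ∈ T, 0 < p.1 ∧ 0 < p.2 ∧ p.1.Coprime p.2 ∧ (p.1 : ℝ) ≤ L ∧ (p.2 : ℝ) ≤ L ∧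
      HasSplitting P Q m (polyM P Q p.1 p.2)) :
    T.card ≤ 2 * classCount n P.leadingCoeff (Q.coeff 0) L H := by
  obtain ⟨α, β, hα, hβ, hr⟩ := hroots
  rcases le_or_gt ‖β‖ 2 with hβ2 | hβ2
  · exact hPQ.card_le_of_norm_le_two hm hL hα hβ hβ2 hr hr1 hsm T hT
  · have hα1 : 1 ≤ ‖α‖ := by
      have := norm_sub_norm_le β α
      rw [norm_sub_rev] at this
      linarith
    have hα0 : α ≠ 0 := norm_pos_iff.1 (by linarith)
    have hβ0 : β ≠ 0 := norm_pos_iff.1 (by linarith)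
    -- Inversion does not increase the distance, as both roots have modulus at least `1`. The new
    -- base point is `α⁻¹`, a root of the reversed `P`.
    have hr' : ‖β⁻¹ - α⁻¹‖ ≤ r := by
      rw [inv_sub_inv hβ0 hα0, norm_div, norm_mul]
      refine (div_le_self (norm_nonneg _) ?_).trans hr
      nlinarith
    have hα2 : ‖α⁻¹‖ ≤ 2 := by
      rw [norm_inv]
      exact (inv_le_one_of_one_le₀ hα1).trans (by norm_num)
    have key := hPQ.reflect.card_le_of_norm_le_two hm hL
      (aeval_inv_reflect hPQ.natDegree_right.le hβ0 hβ)
      (aeval_inv_reflect hPQ.natDegree_left.le hα0 hα) hα2 hr' hr1 hsm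
      (T.map (Equiv.prodComm ℕ ℕ).toEmbedding) (by
        intro p hp
        obtain ⟨q, hq, rfl⟩ := Finset.mem_map.1 hp
        obtain ⟨h1, h2, h3, h4, h5, h6⟩ := hT q hq
        refine ⟨h2, h1, h3.symm, h5, h4, ?_⟩
        have h1' : (q.1 : ℤ) ≠ 0 := by exact_mod_cast h1.ne'
        have h2' : (q.2 : ℤ) ≠ 0 := by exact_mod_cast h2.ne'
        have := h6.reflect hPQ (hPQ.natDegree_polyM _ h1') (by
          rw [hPQ.coeff_zero_polyM]
          exact mul_ne_zero h2' hPQ.coeff_zero_right_ne_zero)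
        rwa [← polyM_reflect] at this)
    rw [Finset.card_map, hPQ.leadingCoeff_reflect, hPQ.coeff_zero_reflect] at key
    refine key.trans (le_of_eq ?_)
    unfold classCount
    ring

/-! ### Linear factors for prime parameters. -/

/-- The value of `P + T Q` at the point `a + b T`, as a polynomial in `T`. -/
noncomputable def substPoly (P Q : ℚ[X]) (a b : ℚ) : ℚ[X] :=
  P.comp (C a + C b * X) + X * Q.comp (C a + C b * X)

theorem eval_substPoly (P Q : ℚ[X]) (a b x : ℚ) :
    (substPoly P Q a b).eval x = P.eval (a + b * x) + x * Q.eval (a + b * x) := by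
  simp [substPoly]

theorem natDegree_substPoly_le {n : ℕ} {P Q : ℚ[X]} (hP : P.natDegree ≤ n)
    (hQ : Q.natDegree + 1 ≤ n) (a b : ℚ) : (substPoly P Q a b).natDegree ≤ n := by
  have hlin : (C a + C b * X : ℚ[X]).natDegree ≤ 1 := by
    rw [add_comm]
    exact natDegree_linear_le
  have hcomp : ∀ F : ℚ[X], (F.comp (C a + C b * X)).natDegree ≤ F.natDegree := fun F => by
    rw [natDegree_comp]
    exact (Nat.mul_le_mul_left _ hlin).trans (by simp)
  refine (natDegree_add_le _ _).trans (max_le ((hcomp P).trans hP) ?_)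
  refine natDegree_mul_le.trans ?_
  have := hcomp Q
  rw [natDegree_X]
  omega

theorem substPoly_const_ne_zero {P Q : ℚ[X]} (h : IsCoprime P Q) (a : ℚ) :
    substPoly P Q a 0 ≠ 0 := by
  intro h0
  have e : ∀ x, P.eval a + x * Q.eval a = 0 := fun x => by
    have := eval_substPoly P Q a 0 x
    rw [h0, eval_zero] at this
    simpa using this.symm
  have e0 : P.eval a = 0 := by simpa using e 0
  have e1 : Q.eval a = 0 := by simpa [e0] using e 1
  obtain ⟨u, v, huv⟩ := h
  have := congrArg (eval a) huv
  simp [e0, e1] at this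

/-- Vanishing would mean `b P + X Q = 0`, so `P` would divide `X` by coprimality, which its degree
forbids. -/
theorem substPoly_linear_ne_zero {P Q : ℚ[X]} (h : IsCoprime P Q) (hP : 2 ≤ P.natDegree) {b : ℚ}
    (hb : b ≠ 0) : substPoly P Q 0 b ≠ 0 := by
  intro h0
  have e : C b * P + X * Q = 0 := by
    refine Polynomial.funext fun x => ?_
    have := eval_substPoly P Q 0 b (x / b)
    rw [h0, eval_zero, zero_add, mul_div_cancel₀ _ hb] at this
    rw [eval_add, eval_mul, eval_mul, eval_C, eval_X, eval_zero]
    calc b * P.eval x + x * Q.eval x = b * (P.eval x + x / b * Q.eval x) := by field_simp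
      _ = 0 := by rw [← this, mul_zero]
  have hdvd : P ∣ X * Q := by
    refine ⟨-C b, ?_⟩
    linear_combination e
  have h1 : P ∣ X := h.dvd_of_dvd_mul_right hdvd
  have := natDegree_le_of_dvd h1 X_ne_zero
  rw [natDegree_X] at this
  omega

/-- The parameters `l` for which `P + l Q` can have a linear factor whose outer coefficients are
given up to a factor `l`. -/
noncomputable def linearParams (P Q : ℤ[X]) : Finset ℚ :=
  ((signedDivisors P.leadingCoeff) ×ˢ (signedDivisors (Q.coeff 0))).biUnion fun p =>
    (substPoly (toRat P) (toRat Q) (-p.2 / p.1) 0).roots.toFinset ∪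
      (substPoly (toRat P) (toRat Q) 0 (-p.2 / p.1)).roots.toFinset

theorem AdmissiblePair.card_linearParams_le {n : ℕ} {H : ℝ} {P Q : ℤ[X]}
    (hPQ : AdmissiblePair n H P Q) :
    (linearParams P Q).card ≤ 8 * n * (tauInt P.leadingCoeff * tauInt (Q.coeff 0)) := by
  have hP : (toRat P).natDegree ≤ n := by rw [natDegree_toRat, hPQ.natDegree_left]
  have hQ : (toRat Q).natDegree + 1 ≤ n := by
    rw [natDegree_toRat]
    exact hPQ.natDegree_right
  have hroots : ∀ a b : ℚ, (substPoly (toRat P) (toRat Q) a b).roots.toFinset.card ≤ n :=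
    fun a b => (Multiset.toFinset_card_le _).trans
      ((card_roots' _).trans (natDegree_substPoly_le hP hQ a b))
  refine (Finset.card_biUnion_le_card_mul _ _ (2 * n) fun p _ => ?_).trans ?_
  · refine (Finset.card_union_le _ _).trans ?_
    have h1 := hroots (-p.2 / p.1) 0
    have h2 := hroots 0 (-p.2 / p.1)
    omega
  · rw [Finset.card_product]
    calc _ ≤ (2 * tauInt P.leadingCoeff) * (2 * tauInt (Q.coeff 0)) * (2 * n) := by
          gcongr <;> exact card_signedDivisors_le _
      _ = _ := by ring

theorem dvd_or_eq_prime_mul {l g c : ℤ} (hl : Prime l) (h : g ∣ l * c) :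
    g ∣ c ∨ ∃ g', g = l * g' ∧ g' ∣ c := by
  obtain ⟨u, a, hu, ha, rfl⟩ := exists_dvd_and_dvd_of_dvd_mul h
  rcases hl.irreducible.isUnit_or_isUnit hu.choose_spec with h1 | h1
  · exact Or.inl (h1.mul_left_dvd.2 ha)
  · right
    obtain ⟨w, hw⟩ := h1.exists_right_inv
    refine ⟨w * a, ?_, (IsUnit.of_mul_eq_one _ ((mul_comm _ _).trans hw)).mul_left_dvd.2 ha⟩
    have hu' := hu.choose_spec
    calc u * a = u * (hu.choose * w) * a := by rw [hw, mul_one]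
      _ = (u * hu.choose) * (w * a) := by ring
      _ = l * (w * a) := by rw [← hu']

theorem AdmissiblePair.mem_linearParams {n : ℕ} {H : ℝ} {P Q : ℤ[X]}
    (hPQ : AdmissiblePair n H P Q) (hn : 2 ≤ n) {l : ℤ} (hl : Prime l) {G : ℤ[X]}
    (hG : G.natDegree = 1) (hdvd : G ∣ polyR P Q l) : (l : ℚ) ∈ linearParams P Q := by
  have hM : polyR P Q l = polyM P Q 1 l := by simp [polyR, polyM]
  have hP2 : 2 ≤ (toRat P).natDegree := by rwa [natDegree_toRat, hPQ.natDegree_left]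
  have hcop := hPQ.isCoprime
  have hGX : G = C (G.coeff 1) * X + C (G.coeff 0) :=
    eq_X_add_C_of_natDegree_le_one hG.le
  have ha : G.leadingCoeff = G.coeff 1 := by rw [leadingCoeff, hG]
  rw [hM] at hdvd
  have hlc : G.coeff 1 ∣ P.leadingCoeff := by
    obtain ⟨K, hK⟩ := hdvd
    have := hPQ.leadingCoeff_polyM l one_ne_zero
    rw [hK, leadingCoeff_mul, ha, one_mul] at this
    exact Dvd.intro _ this
  have hc : G.coeff 0 ∣ l * Q.coeff 0 := by
    obtain ⟨K, hK⟩ := hdvd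
    have := hPQ.coeff_zero_polyM 1 l
    rw [hK, mul_coeff_zero] at this
    exact Dvd.intro _ this
  have hG1 : G.coeff 1 ≠ 0 := by
    rw [← ha]
    intro h
    rw [leadingCoeff_eq_zero] at h
    simp [h] at hG
  have hG1' : ((G.coeff 1 : ℤ) : ℚ) ≠ 0 := by exact_mod_cast hG1
  have hroot : (toRat P).eval (-(G.coeff 0 : ℚ) / G.coeff 1)
      + l * (toRat Q).eval (-(G.coeff 0 : ℚ) / G.coeff 1) = 0 := by
    obtain ⟨K, hK⟩ := hdvd
    have h1 : toRat (polyM P Q 1 l) = toRat P + C (l : ℚ) * toRat Q := by simp [polyM, toRat]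
    have h2 : (toRat G).eval (-(G.coeff 0 : ℚ) / G.coeff 1) = 0 := by
      have hGX' : toRat G = C (G.coeff 1 : ℚ) * X + C (G.coeff 0 : ℚ) := by
        conv_lhs => rw [hGX]
        simp [toRat]
      rw [hGX', eval_add, eval_mul, eval_C, eval_C, eval_X, mul_div_cancel₀ _ hG1']
      ring
    have h3 := congrArg (eval (-(G.coeff 0 : ℚ) / G.coeff 1)) h1
    rw [hK] at h3
    simp only [toRat, Polynomial.map_mul, eval_mul, eval_add, eval_C] at h2 h3 ⊢
    rw [h2, zero_mul] at h3
    exact h3.symm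
  have hmem : G.coeff 1 ∈ signedDivisors P.leadingCoeff :=
    mem_signedDivisors hPQ.leadingCoeff_ne_zero hlc
  -- The root of `G` is either one of boundedly many fixed rationals, or such a rational times `l`.
  -- Either way `l` is a root of one of the listed polynomials.
  rcases dvd_or_eq_prime_mul hl hc with hd | ⟨d, hd, hd'⟩
  · refine Finset.mem_biUnion.2 ⟨(G.coeff 1, G.coeff 0), Finset.mem_product.2
      ⟨hmem, mem_signedDivisors hPQ.coeff_zero_right_ne_zero hd⟩, Finset.mem_union_left _ ?_⟩
    rw [Multiset.mem_toFinset, mem_roots (substPoly_const_ne_zero hcop _), IsRoot, eval_substPoly]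
    simpa using hroot
  · refine Finset.mem_biUnion.2 ⟨(G.coeff 1, d), Finset.mem_product.2
      ⟨hmem, mem_signedDivisors hPQ.coeff_zero_right_ne_zero hd'⟩, Finset.mem_union_right _ ?_⟩
    have hd0 : (d : ℚ) ≠ 0 := by
      have : d ≠ 0 := by
        rintro rfl
        exact hPQ.coeff_zero_right_ne_zero (zero_dvd_iff.1 hd')
      exact_mod_cast this
    rw [Multiset.mem_toFinset, mem_roots (substPoly_linear_ne_zero hcop hP2
      (div_ne_zero (neg_ne_zero.2 hd0) hG1')), IsRoot, eval_substPoly]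
    have e : (0 : ℚ) + -(d : ℚ) / G.coeff 1 * l = -(G.coeff 0 : ℚ) / G.coeff 1 := by
      rw [hd]
      push_cast
      ring
    rw [e]
    exact hroot

theorem polyR_eq_polyM (P Q : ℤ[X]) (l : ℤ) : polyR P Q l = polyM P Q 1 l := by
  simp [polyR, polyM]

theorem polyS_eq_polyM (P Q : ℤ[X]) (l : ℤ) : polyS P Q l = polyM P Q l 1 := by
  simp [polyS, polyM]

/-- Reversal turns `S_l` into `R_l` of the reversed pair, and keeps a linear factor linear because
its constant coefficient divides `d₀ ≠ 0`. -/
theorem AdmissiblePair.mem_linearParams_reflect {n : ℕ} {H : ℝ} {P Q : ℤ[X]}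
    (hPQ : AdmissiblePair n H P Q) (hn : 2 ≤ n) {l : ℤ} (hl : Prime l) {G : ℤ[X]}
    (hG : G.natDegree = 1) (hdvd : G ∣ polyS P Q l) :
    (l : ℚ) ∈ linearParams (Q.reflect n) (P.reflect n) := by
  rw [polyS_eq_polyM] at hdvd
  have hG0 : G.coeff 0 ≠ 0 := by
    obtain ⟨K, hK⟩ := hdvd
    have := hPQ.coeff_zero_polyM l 1
    rw [hK, mul_coeff_zero, one_mul] at this
    exact left_ne_zero_of_mul (this ▸ hPQ.coeff_zero_right_ne_zero)
  have h1 : polyM P Q l 1 = (polyR (Q.reflect n) (P.reflect n) l).reflect n := by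
    rw [polyR_eq_polyM, polyM_reflect, reflect_reflect]
  rw [h1] at hdvd
  have h0 := hPQ.reflect.polyM_ne_zero (l₁ := 1) l one_ne_zero
  have hd := hPQ.reflect.natDegree_polyM (l₁ := 1) l one_ne_zero
  rw [← polyR_eq_polyM] at h0 hd
  refine hPQ.reflect.mem_linearParams hn hl ?_ (reflect_dvd h0 hd.le hdvd)
  rw [natDegree_reflect le_rfl hG0, hG]

/-- The primes `l` for which `F_l` has a linear factor. -/
def linearPrimes (F : ℤ[X] → ℤ[X] → ℤ → ℤ[X]) (P Q : ℤ[X]) : Set ℤ :=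
  {l | Prime l ∧ ∃ G : ℤ[X], G.natDegree = 1 ∧ G ∣ F P Q l}

theorem finite_and_ncard_le_of_cast_mem {S : Set ℤ} {T : Finset ℚ} (h : ∀ l ∈ S, (l : ℚ) ∈ T) :
    S.Finite ∧ S.ncard ≤ T.card := by
  have hinj : Set.InjOn (fun l : ℤ => (l : ℚ)) S := Int.cast_injective.injOn
  have hfin : S.Finite := Set.Finite.of_finite_image
    (T.finite_toSet.subset (Set.image_subset_iff.2 h)) hinj
  refine ⟨hfin, ?_⟩
  rw [← Set.ncard_coe_finset]
  exact Set.ncard_le_ncard_of_injOn _ h hinj T.finite_toSet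

theorem AdmissiblePair.ncard_linearPrimes_le {n : ℕ} {H : ℝ} {P Q : ℤ[X]}
    (hPQ : AdmissiblePair n H P Q) (hn : 2 ≤ n) {F : ℤ[X] → ℤ[X] → ℤ → ℤ[X]}
    (hF : F = polyS ∨ F = polyR) : (linearPrimes F P Q).Finite ∧
      (linearPrimes F P Q).ncard ≤ 8 * n * (tauInt P.leadingCoeff * tauInt (Q.coeff 0)) := by
  rcases hF with rfl | rfl
  · obtain ⟨h1, h2⟩ := finite_and_ncard_le_of_cast_mem (S := linearPrimes polyS P Q)
      (T := linearParams (Q.reflect n) (P.reflect n)) (by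
        rintro l ⟨hl, G, hG, hd⟩
        exact hPQ.mem_linearParams_reflect hn hl hG hd)
    refine ⟨h1, h2.trans (hPQ.reflect.card_linearParams_le.trans (le_of_eq ?_))⟩
    rw [hPQ.leadingCoeff_reflect, hPQ.coeff_zero_reflect]
    ring
  · obtain ⟨h1, h2⟩ := finite_and_ncard_le_of_cast_mem (S := linearPrimes polyR P Q)
      (T := linearParams P Q) (by
        rintro l ⟨hl, G, hG, hd⟩
        exact hPQ.mem_linearParams hn hl hG hd)
    exact ⟨h1, h2.trans hPQ.card_linearParams_le⟩

/-! ### From reducible polynomials to splittings. -/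

theorem IsReduciblePoly.exists_mul {M : ℤ[X]} {n : ℕ} (hM : M.natDegree = n)
    (h : IsReduciblePoly M) : ∃ G K : ℤ[X], M = G * K ∧ 1 ≤ G.natDegree ∧ 1 ≤ K.natDegree ∧
      G.natDegree + K.natDegree = n := by
  obtain ⟨G, ⟨K, hK⟩, h1, h2⟩ := h
  have hM0 : M ≠ 0 := by
    rintro rfl
    simp at h2
  have hs : G.natDegree + K.natDegree = n := by
    rw [hK] at hM0
    rw [← natDegree_mul (left_ne_zero_of_mul hM0) (right_ne_zero_of_mul hM0), ← hK, hM]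
  exact ⟨G, K, hK, h1, by omega, hs⟩

theorem AdmissiblePair.natDegree_eq {n : ℕ} {H : ℝ} {P Q : ℤ[X]} (hPQ : AdmissiblePair n H P Q)
    {F : ℤ[X] → ℤ[X] → ℤ → ℤ[X]} (hF : F = polyS ∨ F = polyR) {l : ℤ} (hl : l ≠ 0) :
    (F P Q l).natDegree = n := by
  rcases hF with rfl | rfl
  · rw [polyS_eq_polyM, hPQ.natDegree_polyM _ hl]
  · rw [polyR_eq_polyM, hPQ.natDegree_polyM _ one_ne_zero]

theorem AdmissiblePair.mem_linearPrimes_of_le_three {n : ℕ} {H : ℝ} {P Q : ℤ[X]}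
    (hPQ : AdmissiblePair n H P Q) (hn : n ≤ 3) {F : ℤ[X] → ℤ[X] → ℤ → ℤ[X]}
    (hF : F = polyS ∨ F = polyR) {l : ℤ} (hl : Prime l) (hred : IsReduciblePoly (F P Q l)) :
    l ∈ linearPrimes F P Q := by
  obtain ⟨G, K, hGK, h1, h2, h3⟩ := hred.exists_mul (hPQ.natDegree_eq hF hl.ne_zero)
  rcases (by omega : G.natDegree = 1 ∨ K.natDegree = 1) with h | h
  · exact ⟨hl, G, h, Dvd.intro _ hGK.symm⟩
  · exact ⟨hl, K, h, Dvd.intro_left _ hGK.symm⟩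

theorem dvd_or_dvd_of_mul_eq_prime_mul {l g k c : ℤ} (hl : Prime l) (h : g * k = l * c) :
    g ∣ c ∨ k ∣ c := by
  rcases dvd_or_eq_prime_mul hl (Dvd.intro _ h) with h1 | ⟨g', rfl, -⟩
  · exact Or.inl h1
  · refine Or.inr (Dvd.intro_left g' ?_)
    apply mul_left_cancel₀ hl.ne_zero
    rw [← h, mul_assoc]

/-- The prime enters only one of the two outer coefficients, and there only one of the two factors
must absorb it; the other factor is taken as the first one. -/
theorem AdmissiblePair.hasSplitting_two {n : ℕ} {H : ℝ} {P Q : ℤ[X]}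
    (hPQ : AdmissiblePair n H P Q) {l₁ l₂ : ℤ} (hl : Prime l₁ ∧ l₂ = 1 ∨ l₁ = 1 ∧ Prime l₂)
    (hred : IsReduciblePoly (polyM P Q l₁ l₂))
    (hlin : ¬ ∃ G : ℤ[X], G.natDegree = 1 ∧ G ∣ polyM P Q l₁ l₂) :
    HasSplitting P Q 2 (polyM P Q l₁ l₂) := by
  have hl0 : l₁ ≠ 0 := by
    rcases hl with ⟨h, -⟩ | ⟨h, -⟩
    · exact h.ne_zero
    · rw [h]
      exact one_ne_zero
  obtain ⟨G, K, hGK, h1, h2, h3⟩ := hred.exists_mul (hPQ.natDegree_polyM l₂ hl0)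
  have hG : 2 ≤ G.natDegree := by
    by_contra hcon
    exact hlin ⟨G, by omega, Dvd.intro _ hGK.symm⟩
  have hK : 2 ≤ K.natDegree := by
    by_contra hcon
    exact hlin ⟨K, by omega, Dvd.intro_left _ hGK.symm⟩
  have hlc := hPQ.leadingCoeff_polyM l₂ hl0
  have hc := hPQ.coeff_zero_polyM l₁ l₂
  rw [hGK, leadingCoeff_mul] at hlc
  rw [hGK, mul_coeff_zero] at hc
  have key : G.leadingCoeff ∣ P.leadingCoeff ∧ G.coeff 0 ∣ Q.coeff 0 ∨
      K.leadingCoeff ∣ P.leadingCoeff ∧ K.coeff 0 ∣ Q.coeff 0 := by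
    rcases hl with ⟨h, rfl⟩ | ⟨rfl, h⟩
    · rw [one_mul] at hc
      rcases dvd_or_dvd_of_mul_eq_prime_mul h hlc with h' | h'
      · exact Or.inl ⟨h', Dvd.intro _ hc⟩
      · exact Or.inr ⟨h', Dvd.intro_left _ hc⟩
    · rw [one_mul] at hlc
      rcases dvd_or_dvd_of_mul_eq_prime_mul h hc with h' | h'
      · exact Or.inl ⟨Dvd.intro _ hlc, h'⟩
      · exact Or.inr ⟨Dvd.intro_left _ hlc, h'⟩
  rcases key with h | h
  · exact ⟨G, K, hGK, hG, hK, fun _ => h⟩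
  · exact ⟨K, G, hGK.trans (mul_comm _ _), hK, hG, fun _ => h⟩

/-- The primes `l ≤ L` for which `F_l` is reducible. -/
def reduciblePrimes (F : ℤ[X] → ℤ[X] → ℤ → ℤ[X]) (P Q : ℤ[X]) (L : ℝ) : Set ℕ :=
  {l : ℕ | l.Prime ∧ (l : ℝ) ≤ L ∧ IsReduciblePoly (F P Q l)}

theorem finite_setOf_natCast_le (L : ℝ) : {l : ℕ | (l : ℝ) ≤ L}.Finite :=
  (Set.finite_Iic ⌊L⌋₊).subset fun _ hl => Nat.le_floor hl

theorem AdmissiblePair.ncard_reduciblePrimes_le {n : ℕ} {H : ℝ} {P Q : ℤ[X]}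
    (hPQ : AdmissiblePair n H P Q) (hn : 4 ≤ n) {F : ℤ[X] → ℤ[X] → ℤ → ℤ[X]}
    (hF : F = polyS ∨ F = polyR) {L r : ℝ} (hL : 1 ≤ L) (hroots : HaveCloseRoots P Q r)
    (hr1 : r ≤ 1) (hsm : smallness n 2 L H r < 1) :
    (reduciblePrimes F P Q L).ncard ≤
      8 * n * (tauInt P.leadingCoeff * tauInt (Q.coeff 0)) +
        2 * classCount n P.leadingCoeff (Q.coeff 0) L H := by
  obtain ⟨hlinfin, hlin⟩ := hPQ.ncard_linearPrimes_le (by omega) hF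
  set A : Set ℕ := {l : ℕ | (l : ℤ) ∈ linearPrimes F P Q} with hA
  -- Primes producing a linear factor are in `A`; for those in `B` both factors have degree at least
  -- two.
  set B : Set ℕ := reduciblePrimes F P Q L \ A with hB
  have hAfin : A.Finite := hlinfin.preimage Nat.cast_injective.injOn
  have hBfin : B.Finite := (finite_setOf_natCast_le L).subset fun l hl => hl.1.2.1
  have hAcard : A.ncard ≤ 8 * n * (tauInt P.leadingCoeff * tauInt (Q.coeff 0)) :=
    (Set.ncard_le_ncard_of_injOn (fun l : ℕ => (l : ℤ)) (fun l hl => hl)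
      Nat.cast_injective.injOn hlinfin).trans hlin
  have hBcard : B.ncard ≤ 2 * classCount n P.leadingCoeff (Q.coeff 0) L H := by
    rw [Set.ncard_eq_toFinset_card B hBfin]
    have hmem : ∀ l ∈ hBfin.toFinset, l.Prime ∧ (l : ℝ) ≤ L ∧ IsReduciblePoly (F P Q l) ∧
        ¬ ∃ G : ℤ[X], G.natDegree = 1 ∧ G ∣ F P Q l := by
      intro l hl
      obtain ⟨⟨h1, h2, h3⟩, h4⟩ := hBfin.mem_toFinset.1 hl
      exact ⟨h1, h2, h3, fun h => h4 ⟨Nat.prime_iff_prime_int.1 h1, h⟩⟩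
    rcases hF with rfl | rfl
    · rw [← Finset.card_map ⟨fun l : ℕ => (l, 1), fun a b h => (Prod.mk.inj h).1⟩]
      refine hPQ.card_le (Or.inr rfl) hL hroots hr1 hsm _ fun p hp => ?_
      obtain ⟨l, hl, rfl⟩ := Finset.mem_map.1 hp
      obtain ⟨h1, h2, h3, h4⟩ := hmem l hl
      rw [polyS_eq_polyM] at h3 h4
      refine ⟨h1.pos, one_pos, Nat.coprime_one_right l, h2, (Nat.cast_one (R := ℝ)).trans_le hL, ?_⟩
      exact hPQ.hasSplitting_two (Or.inl ⟨Nat.prime_iff_prime_int.1 h1, rfl⟩) h3 h4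
    · rw [← Finset.card_map ⟨fun l : ℕ => (1, l), fun a b h => (Prod.mk.inj h).2⟩]
      refine hPQ.card_le (Or.inr rfl) hL hroots hr1 hsm _ fun p hp => ?_
      obtain ⟨l, hl, rfl⟩ := Finset.mem_map.1 hp
      obtain ⟨h1, h2, h3, h4⟩ := hmem l hl
      rw [polyR_eq_polyM] at h3 h4
      refine ⟨one_pos, h1.pos, Nat.coprime_one_left l, (Nat.cast_one (R := ℝ)).trans_le hL, h2, ?_⟩
      exact hPQ.hasSplitting_two (Or.inr ⟨rfl, Nat.prime_iff_prime_int.1 h1⟩) h3 h4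
  have hsub : reduciblePrimes F P Q L ⊆ A ∪ B := fun l hl => by
    by_cases h : l ∈ A
    · exact Or.inl h
    · exact Or.inr ⟨hl, h⟩
  exact (Set.ncard_le_ncard hsub (hAfin.union hBfin)).trans
    ((Set.ncard_union_le _ _).trans (add_le_add hAcard hBcard))

/-- The coprime pairs `l₁ < l₂ ≤ L` for which `l₁ P + l₂ Q` is reducible. -/
def reduciblePairs (P Q : ℤ[X]) (L : ℝ) : Set (ℕ × ℕ) :=
  {p : ℕ × ℕ | 1 ≤ p.1 ∧ p.1 < p.2 ∧ (p.2 : ℝ) ≤ L ∧ p.1.Coprime p.2 ∧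
    IsReduciblePoly (polyM P Q p.1 p.2)}

theorem finite_setOf_pairs_le (L : ℝ) : {p : ℕ × ℕ | p.1 < p.2 ∧ (p.2 : ℝ) ≤ L}.Finite :=
  ((Set.finite_Iic ⌊L⌋₊).prod (Set.finite_Iic ⌊L⌋₊)).subset fun _ hp =>
    ⟨hp.1.le.trans (Nat.le_floor hp.2), Nat.le_floor hp.2⟩

theorem finite_reduciblePairs (P Q : ℤ[X]) (L : ℝ) : (reduciblePairs P Q L).Finite :=
  (finite_setOf_pairs_le L).subset fun _ hp => ⟨hp.2.1, hp.2.2.1⟩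

theorem AdmissiblePair.ncard_reduciblePairs_le {n : ℕ} {H : ℝ} {P Q : ℤ[X]}
    (hPQ : AdmissiblePair n H P Q) {L r : ℝ} (hL : 1 ≤ L) (hroots : HaveCloseRoots P Q r)
    (hr1 : r ≤ 1) (hsm : smallness n 1 L H r < 1) :
    (reduciblePairs P Q L).ncard ≤ 2 * classCount n P.leadingCoeff (Q.coeff 0) L H := by
  have hfin := finite_reduciblePairs P Q L
  rw [Set.ncard_eq_toFinset_card _ hfin]
  refine hPQ.card_le (Or.inl rfl) hL hroots hr1 hsm _ fun p hp => ?_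
  obtain ⟨h1, h2, h3, h4, h5⟩ := hfin.mem_toFinset.1 hp
  have h6 : (p.1 : ℝ) ≤ p.2 := by exact_mod_cast h2.le
  obtain ⟨G, K, hGK, hG, hK, -⟩ := h5.exists_mul
    (hPQ.natDegree_polyM _ (by exact_mod_cast Nat.one_le_iff_ne_zero.1 h1))
  exact ⟨h1, by omega, h4, h6.trans h3, h3, G, K, hGK, hG, hK, fun h => by omega⟩

/-! ### From coprime pairs to all pairs. -/

theorem IsReduciblePoly.of_C_mul {g : ℤ} (hg : g ≠ 0) {F : ℤ[X]} (h : IsReduciblePoly (C g * F)) :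
    IsReduciblePoly F := by
  obtain ⟨G, hGF, h1, h2⟩ := h
  rw [natDegree_C_mul hg] at h2
  refine ⟨G.primPart, ?_, by rwa [natDegree_primPart], by rwa [natDegree_primPart]⟩
  rw [IsPrimitive.Int.dvd_iff_map_cast_dvd_map_cast _ _ G.isPrimitive_primPart]
  have h3 : toRat G.primPart ∣ C (g : ℚ) * toRat F := by
    have := (Polynomial.map_dvd (Int.castRingHom ℚ) (G.primPart_dvd.trans hGF))
    simpa [toRat] using this
  exact (isUnit_C.2 (isUnit_iff_ne_zero.2 (by exact_mod_cast hg))).dvd_mul_left.1 h3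

/-- A pair is determined by its reduced pair and its gcd; removing the gcd preserves reducibility,
and the gcd takes at most `⌊L⌋₊` values. -/
theorem ncard_reducible_pairs_le (P Q : ℤ[X]) {L : ℝ} :
    {p : ℕ × ℕ | 1 ≤ p.1 ∧ p.1 < p.2 ∧ (p.2 : ℝ) ≤ L ∧
      IsReduciblePoly (polyM P Q p.1 p.2)}.ncard ≤ (reduciblePairs P Q L).ncard * ⌊L⌋₊ := by
  have hN : (↑(Finset.Icc 1 ⌊L⌋₊) : Set ℕ).ncard = ⌊L⌋₊ := by
    rw [Set.ncard_coe_finset, Nat.card_Icc, Nat.add_sub_cancel]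
  conv_rhs => rw [← hN, ← Set.ncard_prod]
  refine Set.ncard_le_ncard_of_injOn
    (fun p : ℕ × ℕ => ((p.1 / p.1.gcd p.2, p.2 / p.1.gcd p.2), p.1.gcd p.2)) ?_ ?_
    ((finite_reduciblePairs P Q L).prod (Finset.finite_toSet _))
  · rintro ⟨a, b⟩ ⟨h1, h2, h3, h4⟩
    dsimp only at h1 h2 h3 h4 ⊢
    have hg : 0 < a.gcd b := Nat.gcd_pos_of_pos_left _ h1
    obtain ⟨a', ha⟩ := Nat.gcd_dvd_left a b
    obtain ⟨b', hb⟩ := Nat.gcd_dvd_right a b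
    have hcop := Nat.coprime_div_gcd_div_gcd hg
    set g := a.gcd b with hgdef
    have ea : a / g = a' := by rw [ha, Nat.mul_div_cancel_left _ hg]
    have eb : b / g = b' := by rw [hb, Nat.mul_div_cancel_left _ hg]
    rw [ea, eb] at hcop ⊢
    have hb'b : b' ≤ b := by
      rw [hb]
      exact Nat.le_mul_of_pos_left _ hg
    have hgb : g ≤ b := Nat.le_of_dvd (by omega) (Dvd.intro _ hb.symm)
    refine ⟨⟨?_, ?_, ?_, hcop, ?_⟩, ?_⟩
    · refine Nat.pos_of_ne_zero fun h0 => ?_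
      change a' = 0 at h0
      rw [h0, mul_zero] at ha
      omega
    · rw [ha, hb] at h2
      exact lt_of_mul_lt_mul_left h2 hg.le
    · exact le_trans (by exact_mod_cast hb'b) h3
    · refine IsReduciblePoly.of_C_mul (g := (g : ℤ)) (by exact_mod_cast hg.ne') ?_
      have e : polyM P Q a b = C (g : ℤ) * polyM P Q a' b' := by
        conv_lhs => rw [ha, hb]
        simp only [polyM]
        push_cast
        rw [C_mul, C_mul]
        ring
      rwa [← e]
    · rw [Finset.coe_Icc]
      exact ⟨hg, hgb.trans (Nat.le_floor h3)⟩
  · rintro ⟨a, b⟩ _ ⟨c, d⟩ _ h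
    simp only [Prod.mk.injEq] at h
    obtain ⟨⟨h1, h2⟩, h3⟩ := h
    have e1 := Nat.div_mul_cancel (Nat.gcd_dvd_left a b)
    have e2 := Nat.div_mul_cancel (Nat.gcd_dvd_right a b)
    rw [h1, h3, Nat.div_mul_cancel (Nat.gcd_dvd_left c d)] at e1
    rw [h2, h3, Nat.div_mul_cancel (Nat.gcd_dvd_right c d)] at e2
    rw [e1, e2]

/-! ### The divisor bound. -/

theorem add_one_le_mul_rpow {η : ℝ} (hη : 0 < η) {p : ℕ} (hp : 2 ≤ p) (v : ℕ) :
    (v : ℝ) + 1 ≤ max 1 (1 / (η * Real.log 2)) * ((p : ℝ) ^ v) ^ η := by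
  set K := max 1 (1 / (η * Real.log 2)) with hK
  have hlog2 : 0 < Real.log 2 := Real.log_pos (by norm_num)
  have hp' : (2 : ℝ) ≤ p := by exact_mod_cast hp
  have h1 : 1 ≤ K := le_max_left _ _
  have h2 : 1 ≤ K * (η * Real.log 2) := by
    have : 1 / (η * Real.log 2) ≤ K := le_max_right _ _
    rwa [div_le_iff₀ (by positivity)] at this
  have h3 : 1 + η * Real.log 2 * v ≤ ((p : ℝ) ^ v) ^ η := by
    rw [Real.rpow_def_of_pos (by positivity), Real.log_pow]
    have h4 : Real.log 2 ≤ Real.log p := Real.log_le_log (by norm_num) hp'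
    have h5 := Real.add_one_le_exp (v * Real.log p * η)
    have h6 : η * Real.log 2 * v ≤ v * Real.log p * η := by
      calc η * Real.log 2 * v = v * Real.log 2 * η := by ring
        _ ≤ _ := by gcongr
    linarith
  calc (v : ℝ) + 1 ≤ K * (η * Real.log 2) * v + K := by
        have : (v : ℝ) ≤ K * (η * Real.log 2) * v := le_mul_of_one_le_left (by positivity) h2
        linarith
    _ = K * (1 + η * Real.log 2 * v) := by ring
    _ ≤ _ := by gcongr

/-- The divisor bound `τ(n) ≪ n ^ η`. -/
theorem exists_card_divisors_le {η : ℝ} (hη : 0 < η) :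
    ∃ A : ℝ, 1 ≤ A ∧ ∀ n : ℕ, n ≠ 0 → (n.divisors.card : ℝ) ≤ A * (n : ℝ) ^ η := by
  set K := max 1 (1 / (η * Real.log 2)) with hK
  have hK1 : 1 ≤ K := le_max_left _ _
  -- Primes `p ≥ B` satisfy `p ^ η ≥ 2`, so `v + 1 ≤ 2 ^ v` suffices for them; each of the fewer
  -- than `B` smaller primes in the factorization costs a factor `K`.
  obtain ⟨B, hB⟩ := exists_nat_ge ((2 : ℝ) ^ (1 / η))
  refine ⟨K ^ B, one_le_pow₀ hK1, fun n hn => ?_⟩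
  have hterm : ∀ p ∈ n.primeFactors, ((n.factorization p : ℝ) + 1) ≤
      (if p < B then K else 1) * ((p : ℝ) ^ n.factorization p) ^ η := by
    intro p hp
    have hp2 := (Nat.prime_of_mem_primeFactors hp).two_le
    split_ifs with h
    · exact add_one_le_mul_rpow hη hp2 _
    · rw [one_mul, ← Real.rpow_natCast_mul (by positivity), mul_comm,
        Real.rpow_mul_natCast (by positivity)]
      have h1 : (2 : ℝ) ≤ (p : ℝ) ^ η := by
        have h2 : (2 : ℝ) ^ (1 / η) ≤ p := hB.trans (by exact_mod_cast not_lt.1 h)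
        calc (2 : ℝ) = ((2 : ℝ) ^ (1 / η)) ^ η := by
              rw [← Real.rpow_mul (by norm_num), one_div_mul_cancel hη.ne', Real.rpow_one]
          _ ≤ _ := by gcongr
      calc ((n.factorization p : ℝ) + 1) ≤ 2 ^ n.factorization p := by
            exact_mod_cast (Nat.lt_two_pow_self (n := n.factorization p))
        _ ≤ _ := by gcongr
  have hprod : (n : ℝ) = ∏ p ∈ n.primeFactors, (p : ℝ) ^ n.factorization p := by
    conv_lhs => rw [← Nat.prod_factorization_pow_eq_self hn]
    rw [Finsupp.prod, Nat.support_factorization]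
    push_cast
    rfl
  have hpow : (n : ℝ) ^ η = ∏ p ∈ n.primeFactors, ((p : ℝ) ^ n.factorization p) ^ η := by
    conv_lhs => rw [hprod]
    rw [Real.finsetProd_rpow _ _ fun p _ => by positivity]
  have hKprod : ∏ p ∈ n.primeFactors, (if p < B then K else 1) ≤ K ^ B := by
    rw [Finset.prod_ite, Finset.prod_const, Finset.prod_const_one, mul_one]
    refine pow_le_pow_right₀ hK1 ?_
    calc _ ≤ (Finset.range B).card := Finset.card_le_card fun p hp =>
          Finset.mem_range.2 (Finset.mem_filter.1 hp).2
      _ = B := Finset.card_range B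
  rw [Nat.card_divisors hn]
  push_cast
  calc _ ≤ ∏ p ∈ n.primeFactors, ((if p < B then K else 1) *
          ((p : ℝ) ^ n.factorization p) ^ η) :=
        Finset.prod_le_prod (fun p _ => by positivity) hterm
    _ = (∏ p ∈ n.primeFactors, (if p < B then K else 1)) * (n : ℝ) ^ η := by
        rw [Finset.prod_mul_distrib, hpow]
    _ ≤ _ := by gcongr

/-! ### Asymptotics of the counting bounds. -/

open Filter

theorem AdmissiblePair.tauInt_le {n : ℕ} {H : ℝ} {P Q : ℤ[X]} (hPQ : AdmissiblePair n H P Q)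
    {η A : ℝ} (hη : 0 < η) (hA1 : 1 ≤ A)
    (hA : ∀ n : ℕ, n ≠ 0 → (n.divisors.card : ℝ) ≤ A * (n : ℝ) ^ η) :
    (tauInt P.leadingCoeff : ℝ) ≤ A * H ^ η ∧ (tauInt (Q.coeff 0) : ℝ) ≤ A * H ^ η := by
  have key : ∀ a : ℤ, a ≠ 0 → |(a : ℝ)| ≤ H → (tauInt a : ℝ) ≤ A * H ^ η := by
    intro a ha haH
    refine (hA _ (Int.natAbs_ne_zero.2 ha)).trans ?_
    have : (a.natAbs : ℝ) ≤ H := by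
      rwa [← Int.cast_abs, Int.abs_eq_natAbs, Int.cast_natCast] at haH
    gcongr
  exact ⟨key _ hPQ.leadingCoeff_ne_zero (hPQ.abs_coeff_left_le _),
    key _ hPQ.coeff_zero_right_ne_zero (hPQ.abs_coeff_right_le _)⟩

theorem eventually_bigGamma_le {η : ℝ} (hη : 0 < η) (C : ℝ) : ∀ᶠ H : ℝ in atTop, ∀ n : ℕ,
    ∀ P Q : ℤ[X], AdmissiblePair n H P Q → C * bigGamma P Q H ≤ H ^ η := by
  -- Three of the four quarters of `η` are used: one for each divisor function, and one for the
  -- logarithm together with all constants.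
  obtain ⟨A, hA1, hA⟩ := exists_card_divisors_le (η := η / 4) (by positivity)
  have hlog := isLittleO_log_rpow_atTop (r := η / 4) (by positivity)
  have hC : 0 < |C| + 1 := by positivity
  have h1 := hlog.bound (c := 1 / (A ^ 2 * (|C| + 1))) (by positivity)
  filter_upwards [h1, eventually_ge_atTop 1] with H hH hH1 n P Q hPQ
  obtain ⟨hc, hd⟩ := hPQ.tauInt_le (by positivity) hA1 hA
  have hlog0 : 0 ≤ Real.log H := Real.log_nonneg hH1
  rw [Real.norm_of_nonneg hlog0, Real.norm_of_nonneg (by positivity)] at hH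
  have hlogle : A ^ 2 * (|C| + 1) * Real.log H ≤ H ^ (η / 4) := by
    rw [one_div, inv_mul_eq_div, le_div_iff₀ (by positivity)] at hH
    linarith
  have hpow : H ^ (η / 4) * H ^ (η / 4) * H ^ (η / 4) ≤ H ^ η := by
    rw [← Real.rpow_add (by linarith), ← Real.rpow_add (by linarith)]
    exact Real.rpow_le_rpow_of_exponent_le hH1 (by linarith)
  have hΓ0 : 0 ≤ bigGamma P Q H := by
    unfold bigGamma
    positivity
  calc C * bigGamma P Q H ≤ (|C| + 1) * bigGamma P Q H := by
        gcongr
        linarith [le_abs_self C]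
    _ ≤ (|C| + 1) * (A * H ^ (η / 4) * (A * H ^ (η / 4)) * Real.log H) := by
        unfold bigGamma
        gcongr
    _ = H ^ (η / 4) * H ^ (η / 4) * (A ^ 2 * (|C| + 1) * Real.log H) := by ring
    _ ≤ H ^ (η / 4) * H ^ (η / 4) * H ^ (η / 4) := by gcongr
    _ ≤ _ := hpow

/-- The count of linear factors involves no logarithm; `Γ'` dominates it because `log H / log log H
≥ 1`. -/
theorem tauInt_mul_le_bigGamma' (P Q : ℤ[X]) {H : ℝ} (h0 : 0 ≤ Real.log H)
    (h1 : 1 ≤ Real.log (Real.log H)) : ((tauInt P.leadingCoeff * tauInt (Q.coeff 0) : ℕ) : ℝ) ≤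
      bigGamma' P Q H ∧ bigGamma' P Q H ≤ bigGamma P Q H := by
  have hloglog : Real.log (Real.log H) ≤ Real.log H := Real.log_le_self h0
  have hpos : 0 < Real.log (Real.log H) := by linarith
  unfold bigGamma' bigGamma
  push_cast
  constructor
  · refine le_mul_of_one_le_right (by positivity) ?_
    rwa [le_div_iff₀ hpos, one_mul]
  · gcongr
    exact div_le_self h0 h1

theorem eventually_one_le_log_log : ∀ᶠ H : ℝ in atTop, 1 ≤ H ∧ 1 ≤ Real.log H ∧
    1 ≤ Real.log (Real.log H) :=
  (eventually_ge_atTop 1).and ((Real.tendsto_log_atTop.eventually_ge_atTop 1).and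
    ((Real.tendsto_log_atTop.comp Real.tendsto_log_atTop).eventually_ge_atTop 1))

theorem eventually_classCount_le (n : ℕ) {δ : ℝ} (hδ : δ ≤ 1) : ∀ᶠ H : ℝ in atTop,
    ∀ P Q : ℤ[X], (2 * classCount n P.leadingCoeff (Q.coeff 0) (H ^ δ) H : ℕ) ≤
      48 * (n + 1) * bigGamma P Q H := by
  filter_upwards [eventually_one_le_log_log, eventually_ge_atTop ((2 : ℝ) ^ n * (n + 1) * 4)]
    with H ⟨hH1, hlog1, _⟩ hH2 P Q
  have hY : heightConst n (H ^ δ) H ≤ H ^ 3 := by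
    have h1 : H ^ δ ≤ H := by
      simpa using Real.rpow_le_rpow_of_exponent_le hH1 hδ
    calc heightConst n (H ^ δ) H = (2 ^ n * (n + 1) * 4) * (H ^ δ) * H := by
          unfold heightConst; ring
      _ ≤ H * H * H := by gcongr
      _ = H ^ 3 := by ring
  -- Here `5` exceeds `3 / log 2`, and the further `+ 1` in the number of dyadic classes is absorbed
  -- by one more `log H`.
  have hJ : (Nat.log 2 ⌊heightConst n (H ^ δ) H⌋₊ : ℝ) ≤ 5 * Real.log H := by
    set N := ⌊heightConst n (H ^ δ) H⌋₊ with hN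
    rcases Nat.eq_zero_or_pos N with h0 | hpos
    · rw [h0]
      simp
      linarith
    · have h1 : ((2 : ℝ) ^ Nat.log 2 N) ≤ H ^ 3 := by
        have h2 : ((2 ^ Nat.log 2 N : ℕ) : ℝ) ≤ N := by
          exact_mod_cast Nat.pow_log_le_self 2 hpos.ne'
        push_cast at h2
        refine h2.trans ((Nat.floor_le ?_).trans hY)
        unfold heightConst
        positivity
      have h3 := Real.log_le_log (by positivity) h1
      rw [Real.log_pow, Real.log_pow] at h3
      have h4 := Real.log_two_gt_d9
      have h5 : (0 : ℝ) ≤ Nat.log 2 N := by positivity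
      push_cast at h3
      nlinarith
  have hτ : (0 : ℝ) ≤ tauInt P.leadingCoeff * tauInt (Q.coeff 0) := by positivity
  unfold classCount bigGamma
  push_cast
  calc _ = 8 * ((n : ℝ) + 1) * (tauInt P.leadingCoeff * tauInt (Q.coeff 0) *
        (Nat.log 2 ⌊heightConst n (H ^ δ) H⌋₊ + 1)) := by ring
    _ ≤ 8 * ((n : ℝ) + 1) * (tauInt P.leadingCoeff * tauInt (Q.coeff 0) *
        (6 * Real.log H)) := by
        gcongr
        linarith
    _ = _ := by ring

/-- The powers of `H` outside `L = H ^ δ` cancel up to `H ^ (-ε)`. The powers of `L` add up to `4n +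
2` from `pairConst ^ 2`, `E` from `heightConst`, and one from the value of `M`. -/
theorem eventually_smallness_lt {n m : ℕ} {δ ε : ℝ}
    (hδ : δ * (4 * n + 3 + (2 * (n - m) - 3 : ℕ)) < ε) : ∀ᶠ H : ℝ in atTop,
    smallness n m (H ^ δ) H (H ^ (-(1 + ((2 * (n - m) - 3 : ℕ) : ℝ)) - ε)) < 1 := by
  set E := 2 * (n - m) - 3 with hE
  set K : ℝ := lipConst n ^ 2 * ((2 * n).factorial * 2 ^ (2 * n) * 2 ^ (2 * n) * 4) ^ 2 *
    (2 ^ n * (n + 1) * 4) ^ E with hK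
  have hlim : Tendsto (fun H : ℝ => K * H ^ (δ * (4 * n + 3 + E) - ε)) atTop (nhds 0) := by
    have h1 := tendsto_rpow_neg_atTop (y := ε - δ * (4 * n + 3 + E)) (by linarith)
    rw [neg_sub] at h1
    simpa using h1.const_mul K
  filter_upwards [hlim.eventually_lt_const one_pos, eventually_gt_atTop 0] with H hH hH0
  refine lt_of_eq_of_lt ?_ hH
  have e1 : (H ^ δ) ^ (4 * n + 3 + E) * H ^ (1 + E) * H ^ (-(1 + (E : ℝ)) - ε) =
      H ^ (δ * (4 * n + 3 + E) - ε) := by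
    rw [← Real.rpow_mul_natCast hH0.le, ← Real.rpow_natCast H (1 + E), ← Real.rpow_add hH0,
      ← Real.rpow_add hH0]
    congr 1
    push_cast
    ring
  rw [← e1]
  unfold smallness pairConst heightConst
  rw [← hE, hK]
  simp only [mul_pow, ← pow_mul, pow_add]
  ring

/-! ### Many irreducible members. -/

/-- In Chebyshev's lower bound the constant `log 2` exceeds `1 / 2`, which leaves room for the
logarithmic error term. -/
theorem eventually_primeCounting_ge :
    ∀ᶠ x : ℝ in atTop, x / (2 * Real.log x) ≤ Nat.primeCounting ⌊x⌋₊ := by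
  have hlog := Real.isLittleO_log_id_atTop.bound (c := 1 / 100) (by norm_num)
  filter_upwards [hlog, eventually_ge_atTop 100] with x hx hx1
  have hlogx : 0 < Real.log x := Real.log_pos (by linarith)
  rw [id, Real.norm_of_nonneg hlogx.le, Real.norm_of_nonneg (by linarith)] at hx
  refine le_trans ?_ (Chebyshev.pi_ge' (by linarith))
  have h1 : Real.log (x + 2) ≤ 1 + Real.log x := by
    have h2 : Real.log (x + 2) ≤ Real.log (2 * x) := Real.log_le_log (by linarith) (by linarith)
    rw [Real.log_mul (by norm_num) (by linarith)] at h2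
    linarith [Real.log_two_lt_d9]
  have h3 := Real.log_two_gt_d9
  rw [← div_div, div_le_div_iff_of_pos_right hlogx]
  nlinarith

theorem finite_reduciblePrimes (F : ℤ[X] → ℤ[X] → ℤ → ℤ[X]) (P Q : ℤ[X]) (L : ℝ) :
    (reduciblePrimes F P Q L).Finite :=
  (finite_setOf_natCast_le L).subset fun _ hl => hl.2.1

theorem primeCounting_le_ncard_add (F : ℤ[X] → ℤ[X] → ℤ → ℤ[X]) (P Q : ℤ[X]) (L : ℝ) :
    Nat.primeCounting ⌊L⌋₊ ≤
      {l : ℕ | l.Prime ∧ (l : ℝ) ≤ L ∧ ¬ IsReduciblePoly (F P Q l)}.ncard +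
        (reduciblePrimes F P Q L).ncard := by
  rw [← Nat.primesLE_card_eq_primeCounting, ← Set.ncard_coe_finset]
  refine le_trans (Set.ncard_le_ncard (fun l hl => ?_) ?_) (Set.ncard_union_le _ _)
  · have h1 := Nat.mem_primesLE.1 hl
    have h2 : (l : ℝ) ≤ L := (Nat.le_floor_iff' h1.2.ne_zero).1 h1.1
    by_cases h : IsReduciblePoly (F P Q l)
    · exact Or.inr ⟨h1.2, h2, h⟩
    · exact Or.inl ⟨h1.2, h2, h⟩
  · exact ((finite_setOf_natCast_le L).subset fun _ hl => hl.2.1).union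
      (finite_reduciblePrimes F P Q L)

/-- If few of the polynomials `F_l` for primes `l ≤ H ^ δ` are reducible, then many are
irreducible. -/
theorem eventually_ncard_irreducible_primes_ge {δ : ℝ} (hδ : 0 < δ) (C : ℝ) :
    ∀ᶠ H : ℝ in atTop, ∀ n : ℕ, ∀ P Q : ℤ[X], AdmissiblePair n H P Q →
      ∀ F : ℤ[X] → ℤ[X] → ℤ → ℤ[X],
      ((reduciblePrimes F P Q (H ^ δ)).ncard : ℝ) ≤ C * bigGamma P Q H →
      1 / (4 * δ) * (H ^ δ / Real.log H) ≤
        ({l : ℕ | l.Prime ∧ (l : ℝ) ≤ H ^ δ ∧ ¬ IsReduciblePoly (F P Q l)}.ncard : ℝ) := by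
  have h1 := (tendsto_rpow_atTop hδ).eventually eventually_primeCounting_ge
  have h2 := eventually_bigGamma_le (half_pos hδ) C
  have h3 := (isLittleO_log_rpow_atTop (r := δ / 2) (half_pos hδ)).bound
    (c := 1 / (4 * δ)) (by positivity)
  filter_upwards [h1, h2, h3, eventually_one_le_log_log] with H h1 h2 h3 ⟨hH1, hlog1, _⟩ n P Q hPQ
    F hbad
  have hH0 : 0 < H := by linarith
  have hlog0 : 0 < Real.log H := by linarith
  have h4 := h2 n P Q hPQ
  rw [Real.norm_of_nonneg hlog0.le, Real.norm_of_nonneg (by positivity)] at h3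
  have h5 : H ^ (δ / 2) ≤ 1 / (4 * δ) * (H ^ δ / Real.log H) := by
    have e : H ^ δ = H ^ (δ / 2) * H ^ (δ / 2) := by
      rw [← Real.rpow_add hH0, add_halves]
    rw [mul_div_assoc', le_div_iff₀ hlog0, e]
    calc H ^ (δ / 2) * Real.log H ≤ H ^ (δ / 2) * (1 / (4 * δ) * H ^ (δ / 2)) := by gcongr
      _ = _ := by ring
  rw [Real.log_rpow hH0] at h1
  have h6 : (Nat.primeCounting ⌊H ^ δ⌋₊ : ℝ) ≤
      {l : ℕ | l.Prime ∧ (l : ℝ) ≤ H ^ δ ∧ ¬ IsReduciblePoly (F P Q l)}.ncard +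
        (reduciblePrimes F P Q (H ^ δ)).ncard := by
    exact_mod_cast primeCounting_le_ncard_add F P Q (H ^ δ)
  -- The primes number at least twice the target, and the reducible cases cost at most `H ^ (δ /
  -- 2)`, hence at most the target.
  have h7 : H ^ δ / (2 * (δ * Real.log H)) = 2 * (1 / (4 * δ) * (H ^ δ / Real.log H)) := by
    field_simp
    ring
  linarith

theorem nonempty_of_pos_le_ncard {S : Set ℕ} {x : ℝ} (hx : 0 < x) (h : x ≤ (S.ncard : ℝ)) :
    S.Nonempty := by
  have : S.ncard ≠ 0 := by
    intro h0
    rw [h0] at h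
    norm_num at h
    linarith
  exact Set.nonempty_of_ncard_ne_zero this

/-- The box with the first entry in the lower half and the second in the upper half consists of
pairs with `l₁ < l₂`. -/
theorem card_pairs_le_ncard_add (P Q : ℤ[X]) (L : ℝ) :
    (⌊L⌋₊ / 2) * (⌊L⌋₊ - ⌊L⌋₊ / 2) ≤
      {p : ℕ × ℕ | 1 ≤ p.1 ∧ p.1 < p.2 ∧ (p.2 : ℝ) ≤ L ∧
        ¬ IsReduciblePoly (polyM P Q p.1 p.2)}.ncard +
      {p : ℕ × ℕ | 1 ≤ p.1 ∧ p.1 < p.2 ∧ (p.2 : ℝ) ≤ L ∧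
        IsReduciblePoly (polyM P Q p.1 p.2)}.ncard := by
  have hcard : ((Finset.Icc 1 (⌊L⌋₊ / 2)) ×ˢ (Finset.Ioc (⌊L⌋₊ / 2) ⌊L⌋₊)).card =
      (⌊L⌋₊ / 2) * (⌊L⌋₊ - ⌊L⌋₊ / 2) := by
    rw [Finset.card_product, Nat.card_Icc, Nat.card_Ioc, Nat.add_sub_cancel]
  rw [← hcard, ← Set.ncard_coe_finset]
  refine le_trans (Set.ncard_le_ncard (fun p hp => ?_) ?_) (Set.ncard_union_le _ _)
  · simp only [Finset.coe_product, Set.mem_prod, Finset.coe_Icc, Finset.coe_Ioc, Set.mem_Icc,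
      Set.mem_Ioc] at hp
    obtain ⟨⟨h1, h2⟩, h3, h4⟩ := hp
    have h5 : (p.2 : ℝ) ≤ L := (Nat.le_floor_iff' (by omega)).1 h4
    by_cases h : IsReduciblePoly (polyM P Q p.1 p.2)
    · exact Or.inr ⟨h1, by omega, h5, h⟩
    · exact Or.inl ⟨h1, by omega, h5, h⟩
  · exact ((finite_setOf_pairs_le L).subset fun _ hp => ⟨hp.2.1, hp.2.2.1⟩).union
      ((finite_setOf_pairs_le L).subset fun _ hp => ⟨hp.2.1, hp.2.2.1⟩)

/-- If few of the polynomials `l₁ P + l₂ Q` with coprime `l₁ < l₂ ≤ H ^ δ` are reducible, then a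
positive proportion of all of them is irreducible. -/
theorem eventually_ncard_irreducible_pairs_ge {δ : ℝ} (hδ : 0 < δ) (C : ℝ) :
    ∀ᶠ H : ℝ in atTop, ∀ n : ℕ, ∀ P Q : ℤ[X], AdmissiblePair n H P Q →
      ((reduciblePairs P Q (H ^ δ)).ncard : ℝ) ≤ C * bigGamma P Q H →
      1 / 32 * H ^ (2 * δ) ≤ ({p : ℕ × ℕ | 1 ≤ p.1 ∧ p.1 < p.2 ∧ (p.2 : ℝ) ≤ H ^ δ ∧
        ¬ IsReduciblePoly (polyM P Q p.1 p.2)}.ncard : ℝ) := by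
  have h1 := (tendsto_rpow_atTop hδ).eventually_ge_atTop 100
  have h2 := eventually_bigGamma_le (half_pos hδ) C
  have h3 := (tendsto_rpow_atTop (half_pos hδ)).eventually_ge_atTop 100
  filter_upwards [h1, h2, h3, eventually_ge_atTop 1] with H h1 h2 h3 hH1 n P Q hPQ hbad
  have hH0 : 0 < H := by linarith
  have h4 := h2 n P Q hPQ
  have e1 : H ^ δ = H ^ (δ / 2) * H ^ (δ / 2) := by rw [← Real.rpow_add hH0, add_halves]
  have e2 : H ^ (2 * δ) = H ^ δ * H ^ δ := by rw [← Real.rpow_add hH0, two_mul]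
  set x := H ^ δ with hx
  set y := H ^ (δ / 2) with hy
  have hfl : (⌊x⌋₊ : ℝ) ≤ x := Nat.floor_le (by linarith)
  have hfl' : x < ⌊x⌋₊ + 1 := Nat.lt_floor_add_one x
  have h5 : ((⌊x⌋₊ / 2 : ℕ) : ℝ) * ((⌊x⌋₊ - ⌊x⌋₊ / 2 : ℕ) : ℝ) ≤
      {p : ℕ × ℕ | 1 ≤ p.1 ∧ p.1 < p.2 ∧ (p.2 : ℝ) ≤ x ∧
        ¬ IsReduciblePoly (polyM P Q p.1 p.2)}.ncard +
      {p : ℕ × ℕ | 1 ≤ p.1 ∧ p.1 < p.2 ∧ (p.2 : ℝ) ≤ x ∧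
        IsReduciblePoly (polyM P Q p.1 p.2)}.ncard := by
    exact_mod_cast card_pairs_le_ncard_add P Q x
  have h6 : ({p : ℕ × ℕ | 1 ≤ p.1 ∧ p.1 < p.2 ∧ (p.2 : ℝ) ≤ x ∧
      IsReduciblePoly (polyM P Q p.1 p.2)}.ncard : ℝ) ≤ (reduciblePairs P Q x).ncard * ⌊x⌋₊ := by
    exact_mod_cast ncard_reducible_pairs_le P Q
  have h7 : ((reduciblePairs P Q x).ncard : ℝ) * ⌊x⌋₊ ≤ y * x :=
    mul_le_mul (hbad.trans h4) hfl (by positivity) (by linarith)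
  have h8 : y * x ≤ 1 / 100 * (x * x) := by
    have : y ≤ 1 / 100 * x := by nlinarith
    nlinarith
  have h9 : 1 / 4 * x ≤ ((⌊x⌋₊ / 2 : ℕ) : ℝ) := by
    have : (⌊x⌋₊ : ℝ) ≤ 2 * ((⌊x⌋₊ / 2 : ℕ) : ℝ) + 1 := by
      exact_mod_cast (by omega : ⌊x⌋₊ ≤ 2 * (⌊x⌋₊ / 2) + 1)
    linarith
  have h10 : 1 / 4 * x ≤ ((⌊x⌋₊ - ⌊x⌋₊ / 2 : ℕ) : ℝ) := by
    refine h9.trans ?_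
    exact_mod_cast (by omega : ⌊x⌋₊ / 2 ≤ ⌊x⌋₊ - ⌊x⌋₊ / 2)
  -- The box gives `x² / 16`, the reducible pairs take away at most `x² / 100`, and `x² / 32`
  -- remains.
  have h11 : (1 / 4 * x) * (1 / 4 * x) ≤
      ((⌊x⌋₊ / 2 : ℕ) : ℝ) * ((⌊x⌋₊ - ⌊x⌋₊ / 2 : ℕ) : ℝ) :=
    mul_le_mul h9 h10 (by linarith) (by positivity)
  rw [e2]
  nlinarith

/-! ### The choice of the exponent and the final assembly. -/

/-- The exponent `δ₀(n, ε)`. -/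
noncomputable def deltaZero (n : ℕ) (ε : ℝ) : ℝ := 1 / (((10 * n * ⌈1 / ε⌉₊ : ℕ) : ℝ) + 1)

theorem effectivelyComputable_deltaZero : EffectivelyComputable deltaZero :=
  ⟨fun n k => 10 * n * k, (Primrec.nat_mul.comp (Primrec.nat_mul.comp (Primrec.const 10)
    Primrec.fst) Primrec.snd).to₂.to_comp, fun _ _ _ => rfl⟩

theorem deltaZero_pos (n : ℕ) (ε : ℝ) : 0 < deltaZero n ε := by
  unfold deltaZero
  positivity

theorem deltaZero_le_one (n : ℕ) (ε : ℝ) : deltaZero n ε ≤ 1 := by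
  unfold deltaZero
  rw [div_le_one (by positivity)]
  exact le_add_of_nonneg_left (by positivity)

theorem deltaZero_mul_lt {n : ℕ} {ε : ℝ} (hε : 0 < ε) : deltaZero n ε * (10 * n) < ε := by
  have h1 : 1 / ε ≤ ⌈1 / ε⌉₊ := Nat.le_ceil _
  rw [div_le_iff₀ hε] at h1
  unfold deltaZero
  rw [one_div, inv_mul_lt_iff₀ (by positivity)]
  push_cast
  have h2 : (0 : ℝ) ≤ 10 * n := by positivity
  nlinarith

/-- The factor `10 n` in `deltaZero` is a crude bound for the total exponent of `L` in `smallness`.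
-/
theorem deltaZero_mul_add_lt {n m : ℕ} (hn : 2 ≤ n) {ε : ℝ} (hε : 0 < ε) :
    deltaZero n ε * (4 * n + 3 + (2 * (n - m) - 3 : ℕ)) < ε := by
  refine lt_of_le_of_lt ?_ (deltaZero_mul_lt (n := n) hε)
  have h1 : 4 * n + 3 + (2 * (n - m) - 3) ≤ 10 * n := by omega
  have h2 := (deltaZero_pos n ε).le
  gcongr
  exact_mod_cast h1

theorem thetaExp_eq {n : ℕ} (hn : 2 ≤ n) :
    thetaExp n = 1 + ((2 * (n - 1) - 3 : ℕ) : ℝ) := by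
  unfold thetaExp
  split_ifs with h
  · subst h
    norm_num
  · rw [Nat.cast_sub (by omega)]
    push_cast [Nat.cast_sub (by omega : 1 ≤ n)]
    ring

theorem two_mul_sub_six_eq {n : ℕ} (hn : 4 ≤ n) :
    2 * (n : ℝ) - 6 = 1 + ((2 * (n - 2) - 3 : ℕ) : ℝ) := by
  rw [Nat.cast_sub (by omega)]
  push_cast [Nat.cast_sub (by omega : 2 ≤ n)]
  ring

theorem rpow_neg_sub_le_one {H : ℝ} (hH : 1 ≤ H) (E : ℕ) {ε : ℝ} (hε : 0 < ε) :
    H ^ (-(1 + (E : ℝ)) - ε) ≤ 1 :=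
  Real.rpow_le_one_of_one_le_of_nonpos hH (by
    have : (0 : ℝ) ≤ E := by positivity
    linarith)

theorem eventually_ncard_reduciblePrimes_le {n : ℕ} (hn : 4 ≤ n)
    {F : ℤ[X] → ℤ[X] → ℤ → ℤ[X]} (hF : F = polyS ∨ F = polyR) {ε : ℝ} (hε : 0 < ε) :
    ∀ᶠ H : ℝ in atTop, ∀ P Q : ℤ[X], AdmissiblePair n H P Q →
      HaveCloseRoots P Q (H ^ (-(2 * (n : ℝ) - 6) - ε)) →
      ((reduciblePrimes F P Q (H ^ deltaZero n ε)).ncard : ℝ) ≤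
        56 * (n + 1) * bigGamma P Q H := by
  filter_upwards [eventually_smallness_lt (deltaZero_mul_add_lt (n := n) (m := 2) (by omega) hε),
    eventually_classCount_le n (deltaZero_le_one n ε), eventually_one_le_log_log] with H h1 h2
    ⟨hH1, hlog1, hll⟩ P Q hPQ hroots
  rw [two_mul_sub_six_eq hn] at hroots
  have h3 := hPQ.ncard_reduciblePrimes_le hn hF
    (Real.one_le_rpow hH1 (deltaZero_pos n ε).le) hroots (rpow_neg_sub_le_one hH1 _ hε) h1
  have h4 := h2 P Q
  obtain ⟨h5, h6⟩ := tauInt_mul_le_bigGamma' P Q (by linarith) hll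
  have h7 := h5.trans h6
  have h8 : 0 ≤ bigGamma P Q H := le_trans (by positivity) h7
  calc ((reduciblePrimes F P Q (H ^ deltaZero n ε)).ncard : ℝ)
      ≤ (8 * n * (tauInt P.leadingCoeff * tauInt (Q.coeff 0)) +
        2 * classCount n P.leadingCoeff (Q.coeff 0) (H ^ deltaZero n ε) H : ℕ) := by
        exact_mod_cast h3
    _ = 8 * n * ((tauInt P.leadingCoeff * tauInt (Q.coeff 0) : ℕ) : ℝ) +
        (2 * classCount n P.leadingCoeff (Q.coeff 0) (H ^ deltaZero n ε) H : ℕ) := by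
        push_cast
        ring
    _ ≤ 8 * n * bigGamma P Q H + 48 * (n + 1) * bigGamma P Q H := by gcongr
    _ ≤ _ := by linarith

theorem eventually_ncard_reduciblePairs_le {n : ℕ} (hn : 2 ≤ n) {ε : ℝ} (hε : 0 < ε) :
    ∀ᶠ H : ℝ in atTop, ∀ P Q : ℤ[X], AdmissiblePair n H P Q →
      HaveCloseRoots P Q (H ^ (-thetaExp n - ε)) →
      ((reduciblePairs P Q (H ^ deltaZero n ε)).ncard : ℝ) ≤
        48 * (n + 1) * bigGamma P Q H := by
  filter_upwards [eventually_smallness_lt (deltaZero_mul_add_lt (n := n) (m := 1) hn hε),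
    eventually_classCount_le n (deltaZero_le_one n ε), eventually_ge_atTop 1] with H h1 h2
    hH1 P Q hPQ hroots
  rw [thetaExp_eq hn] at hroots
  have h3 := hPQ.ncard_reduciblePairs_le (Real.one_le_rpow hH1 (deltaZero_pos n ε).le) hroots
    (rpow_neg_sub_le_one hH1 _ hε) h1
  exact le_trans (by exact_mod_cast h3) (h2 P Q)

theorem reducible_primes_of_le_three {n : ℕ} (hn : n = 2 ∨ n = 3) {F : ℤ[X] → ℤ[X] → ℤ → ℤ[X]}
    (hF : F = polyS ∨ F = polyR) {H : ℝ} (h0 : 0 ≤ Real.log H)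
    (h1 : 1 ≤ Real.log (Real.log H)) {P Q : ℤ[X]} (hPQ : AdmissiblePair n H P Q) :
    {l : ℤ | Prime l ∧ IsReduciblePoly (F P Q l)}.Finite ∧
      ({l : ℤ | Prime l ∧ IsReduciblePoly (F P Q l)}.ncard : ℝ) ≤ 8 * n * bigGamma' P Q H := by
  obtain ⟨hfin, hcard⟩ := hPQ.ncard_linearPrimes_le (by omega) hF
  have hsub : {l : ℤ | Prime l ∧ IsReduciblePoly (F P Q l)} ⊆ linearPrimes F P Q :=
    fun l hl => hPQ.mem_linearPrimes_of_le_three (by omega) hF hl.1 hl.2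
  refine ⟨hfin.subset hsub, ?_⟩
  calc ({l : ℤ | Prime l ∧ IsReduciblePoly (F P Q l)}.ncard : ℝ)
      ≤ (8 * n * (tauInt P.leadingCoeff * tauInt (Q.coeff 0)) : ℕ) := by
        exact_mod_cast (Set.ncard_le_ncard hsub hfin).trans hcard
    _ = 8 * n * ((tauInt P.leadingCoeff * tauInt (Q.coeff 0) : ℕ) : ℝ) := by push_cast; ring
    _ ≤ _ := by
        gcongr
        exact (tauInt_mul_le_bigGamma' P Q h0 h1).1

theorem eventually_many_irreducible_of_le_three {n : ℕ} (hn : n = 2 ∨ n = 3)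
    {F : ℤ[X] → ℤ[X] → ℤ → ℤ[X]} (hF : F = polyS ∨ F = polyR) {δ : ℝ} (hδ : 0 < δ) :
    ∀ᶠ H : ℝ in atTop, ∀ P Q : ℤ[X], AdmissiblePair n H P Q →
      1 / (4 * δ) * (H ^ δ / Real.log H) ≤
        ({l : ℕ | l.Prime ∧ (l : ℝ) ≤ H ^ δ ∧ ¬ IsReduciblePoly (F P Q l)}.ncard : ℝ) := by
  filter_upwards [eventually_ncard_irreducible_primes_ge hδ (8 * n), eventually_one_le_log_log]
    with H h1 ⟨hH1, hlog1, hll⟩ P Q hPQ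
  refine h1 n P Q hPQ F ?_
  obtain ⟨hfin, hcard⟩ := reducible_primes_of_le_three hn hF (by linarith) hll hPQ
  have h2 : (reduciblePrimes F P Q (H ^ δ)).ncard ≤
      {l : ℤ | Prime l ∧ IsReduciblePoly (F P Q l)}.ncard :=
    Set.ncard_le_ncard_of_injOn (fun l : ℕ => (l : ℤ))
      (fun l hl => ⟨Nat.prime_iff_prime_int.1 hl.1, hl.2.2⟩) Nat.cast_injective.injOn hfin
  calc ((reduciblePrimes F P Q (H ^ δ)).ncard : ℝ) ≤ _ := by exact_mod_cast h2
    _ ≤ 8 * n * bigGamma' P Q H := hcard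
    _ ≤ _ := by
        gcongr
        exact (tauInt_mul_le_bigGamma' P Q (by linarith) hll).2

theorem eventually_many_irreducible_primes {n : ℕ} (hn : 4 ≤ n)
    {F : ℤ[X] → ℤ[X] → ℤ → ℤ[X]} (hF : F = polyS ∨ F = polyR) {ε : ℝ} (hε : 0 < ε) {δ : ℝ}
    (hδ : 0 < δ) (hδ' : δ ≤ deltaZero n ε) :
    ∀ᶠ H : ℝ in atTop, ∀ P Q : ℤ[X], AdmissiblePair n H P Q →
      HaveCloseRoots P Q (H ^ (-(2 * (n : ℝ) - 6) - ε)) →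
      1 / 32 * (H ^ δ / Real.log H) ≤
        ({l : ℕ | l.Prime ∧ (l : ℝ) ≤ H ^ δ ∧ ¬ IsReduciblePoly (F P Q l)}.ncard : ℝ) := by
  filter_upwards [eventually_ncard_irreducible_primes_ge hδ (56 * (n + 1)),
    eventually_ncard_reduciblePrimes_le hn hF hε, eventually_one_le_log_log]
    with H h1 h2 ⟨hH1, hlog1, _⟩ P Q hPQ hroots
  have hδ1 : δ ≤ 1 := hδ'.trans (deltaZero_le_one n ε)
  have h3 : (reduciblePrimes F P Q (H ^ δ)).ncard ≤
      (reduciblePrimes F P Q (H ^ deltaZero n ε)).ncard :=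
    Set.ncard_le_ncard (fun l hl => ⟨hl.1,
      hl.2.1.trans (Real.rpow_le_rpow_of_exponent_le hH1 hδ'), hl.2.2⟩)
      (finite_reduciblePrimes F P Q _)
  refine le_trans ?_ (h1 n P Q hPQ F (le_trans (by exact_mod_cast h3) (h2 P Q hPQ hroots)))
  -- The bound `δ ≤ 1` makes the constant absolute; `1 / 32` is chosen to agree with the one for
  -- pairs.
  have h4 : (1 : ℝ) / 32 ≤ 1 / (4 * δ) := by
    apply one_div_le_one_div_of_le <;> linarith
  have h5 : 0 ≤ H ^ δ / Real.log H := by positivity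
  gcongr

theorem eventually_many_irreducible_pairs {n : ℕ} (hn : 2 ≤ n) {ε : ℝ} (hε : 0 < ε) {δ : ℝ}
    (hδ : 0 < δ) (hδ' : δ ≤ deltaZero n ε) :
    ∀ᶠ H : ℝ in atTop, ∀ P Q : ℤ[X], AdmissiblePair n H P Q →
      HaveCloseRoots P Q (H ^ (-thetaExp n - ε)) →
      1 / 32 * H ^ (2 * δ) ≤ ({p : ℕ × ℕ | 1 ≤ p.1 ∧ p.1 < p.2 ∧ (p.2 : ℝ) ≤ H ^ δ ∧
        ¬ IsReduciblePoly (polyM P Q p.1 p.2)}.ncard : ℝ) := by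
  filter_upwards [eventually_ncard_irreducible_pairs_ge hδ (48 * (n + 1)),
    eventually_ncard_reduciblePairs_le hn hε, eventually_ge_atTop 1] with H h1 h2 hH1 P Q hPQ hroots
  have h3 : (reduciblePairs P Q (H ^ δ)).ncard ≤ (reduciblePairs P Q (H ^ deltaZero n ε)).ncard :=
    Set.ncard_le_ncard (fun p hp => ⟨hp.1, hp.2.1,
      hp.2.2.1.trans (Real.rpow_le_rpow_of_exponent_le hH1 hδ'), hp.2.2.2⟩)
      (finite_reduciblePairs P Q _)
  exact h1 n P Q hPQ (le_trans (by exact_mod_cast h3) (h2 P Q hPQ hroots))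

theorem theorem1p7 :
    -- claim (i), for `F = S` and for `F = R`
    (∀ F : ℤ[X] → ℤ[X] → ℤ → ℤ[X], F = polyS ∨ F = polyR → ∀ n : ℕ, n = 2 ∨ n = 3 →
      (∃ C : ℝ, 0 < C ∧ ∃ H₀ : ℝ, ∀ H : ℝ, H₀ ≤ H → ∀ P Q : ℤ[X], AdmissiblePair n H P Q →
        {l : ℤ | Prime l ∧ IsReduciblePoly (F P Q l)}.Finite ∧
        ({l : ℤ | Prime l ∧ IsReduciblePoly (F P Q l)}.ncard : ℝ) ≤ C * bigGamma' P Q H) ∧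
      (∀ η : ℝ, 0 < η → ∃ H₀ : ℝ, ∀ H : ℝ, H₀ ≤ H → ∀ P Q : ℤ[X], AdmissiblePair n H P Q →
        bigGamma' P Q H ≤ H ^ η) ∧
      (∀ δ : ℝ, 0 < δ → ∃ c : ℝ, 0 < c ∧ ∃ H₀ : ℝ, ∀ H : ℝ, H₀ ≤ H →
        ∀ P Q : ℤ[X], AdmissiblePair n H P Q →
        c * (H ^ δ / Real.log H) ≤
          ({l : ℕ | l.Prime ∧ (l : ℝ) ≤ H ^ δ ∧ ¬ IsReduciblePoly (F P Q l)}.ncard : ℝ)) ∧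
      (∀ η : ℝ, 0 < η → ∃ H₀ : ℝ, ∀ H : ℝ, H₀ ≤ H → ∀ P Q : ℤ[X], AdmissiblePair n H P Q →
        ∃ l : ℕ, l.Prime ∧ (l : ℝ) ≤ H ^ η ∧ ¬ IsReduciblePoly (F P Q l))) ∧
    -- claims (ii) and (iii), with a common `δ₀ = δ₀(n, ε)` and an absolute constant `c`
    (∃ δ₀ : ℕ → ℝ → ℝ, EffectivelyComputable δ₀ ∧ (∀ n ε, 0 < ε → 0 < δ₀ n ε) ∧
      ∃ c : ℝ, 0 < c ∧
      -- claim (ii), for `F = S` and for `F = R`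
      (∀ F : ℤ[X] → ℤ[X] → ℤ → ℤ[X], F = polyS ∨ F = polyR → ∀ n : ℕ, 4 ≤ n →
        ∃ C : ℝ, 0 < C ∧ ∀ ε : ℝ, 0 < ε →
        (∃ H₀ : ℝ, ∀ H : ℝ, H₀ ≤ H → ∀ P Q : ℤ[X], AdmissiblePair n H P Q →
          HaveCloseRoots P Q (H ^ (-(2 * (n : ℝ) - 6) - ε)) →
          ({l : ℕ | l.Prime ∧ (l : ℝ) ≤ H ^ δ₀ n ε ∧ IsReduciblePoly (F P Q l)}.ncard : ℝ)
            ≤ C * bigGamma P Q H) ∧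
        (∀ η : ℝ, 0 < η → ∃ H₀ : ℝ, ∀ H : ℝ, H₀ ≤ H → ∀ P Q : ℤ[X], AdmissiblePair n H P Q →
          HaveCloseRoots P Q (H ^ (-(2 * (n : ℝ) - 6) - ε)) →
          bigGamma P Q H ≤ H ^ η) ∧
        (∀ δ : ℝ, 0 < δ → δ ≤ δ₀ n ε → ∃ H₀ : ℝ, ∀ H : ℝ, H₀ ≤ H →
          ∀ P Q : ℤ[X], AdmissiblePair n H P Q →
          HaveCloseRoots P Q (H ^ (-(2 * (n : ℝ) - 6) - ε)) →
          c * (H ^ δ / Real.log H) ≤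
            ({l : ℕ | l.Prime ∧ (l : ℝ) ≤ H ^ δ ∧ ¬ IsReduciblePoly (F P Q l)}.ncard : ℝ)) ∧
        (∀ η : ℝ, 0 < η → ∃ H₀ : ℝ, ∀ H : ℝ, H₀ ≤ H → ∀ P Q : ℤ[X], AdmissiblePair n H P Q →
          HaveCloseRoots P Q (H ^ (-(2 * (n : ℝ) - 6) - ε)) →
          ∃ l : ℕ, l.Prime ∧ (l : ℝ) ≤ H ^ η ∧ ¬ IsReduciblePoly (F P Q l))) ∧
      -- claim (iii)
      (∀ n : ℕ, 2 ≤ n → ∃ C : ℝ, 0 < C ∧ ∀ ε : ℝ, 0 < ε →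
        (∃ H₀ : ℝ, ∀ H : ℝ, H₀ ≤ H → ∀ P Q : ℤ[X], AdmissiblePair n H P Q →
          HaveCloseRoots P Q (H ^ (-thetaExp n - ε)) →
          ({p : ℕ × ℕ | 1 ≤ p.1 ∧ p.1 < p.2 ∧ (p.2 : ℝ) ≤ H ^ δ₀ n ε ∧ p.1.Coprime p.2 ∧
              IsReduciblePoly (polyM P Q p.1 p.2)}.ncard : ℝ) ≤ C * bigGamma P Q H) ∧
        (∀ η : ℝ, 0 < η → ∃ H₀ : ℝ, ∀ H : ℝ, H₀ ≤ H → ∀ P Q : ℤ[X], AdmissiblePair n H P Q →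
          HaveCloseRoots P Q (H ^ (-thetaExp n - ε)) →
          bigGamma P Q H ≤ H ^ η) ∧
        (∀ δ : ℝ, 0 < δ → δ ≤ δ₀ n ε → ∃ H₀ : ℝ, ∀ H : ℝ, H₀ ≤ H →
          ∀ P Q : ℤ[X], AdmissiblePair n H P Q →
          HaveCloseRoots P Q (H ^ (-thetaExp n - ε)) →
          c * H ^ (2 * δ) ≤
            ({p : ℕ × ℕ | 1 ≤ p.1 ∧ p.1 < p.2 ∧ (p.2 : ℝ) ≤ H ^ δ ∧
              ¬ IsReduciblePoly (polyM P Q p.1 p.2)}.ncard : ℝ)))) := by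
  refine ⟨fun F hF n hn => ⟨⟨8 * n, ?_, ?_⟩, ?_, ?_, ?_⟩, deltaZero,
    effectivelyComputable_deltaZero, fun n ε _ => deltaZero_pos n ε, 1 / 32, by norm_num,
    fun F hF n hn => ⟨56 * (n + 1), by positivity, fun ε hε => ⟨?_, ?_, ?_, ?_⟩⟩,
    fun n hn => ⟨48 * (n + 1), by positivity, fun ε hε => ⟨?_, ?_, ?_⟩⟩⟩
  · rcases hn with rfl | rfl <;> norm_num
  · obtain ⟨H₀, h⟩ := eventually_atTop.1 eventually_one_le_log_log
    refine ⟨H₀, fun H hH P Q hPQ => ?_⟩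
    obtain ⟨-, h1, h2⟩ := h H hH
    exact reducible_primes_of_le_three hn hF (by linarith) h2 hPQ
  · intro η hη
    obtain ⟨H₀, h⟩ := eventually_atTop.1
      (eventually_one_le_log_log.and (eventually_bigGamma_le hη 1))
    refine ⟨H₀, fun H hH P Q hPQ => ?_⟩
    obtain ⟨⟨-, h1, h2⟩, h3⟩ := h H hH
    have h4 := h3 n P Q hPQ
    rw [one_mul] at h4
    exact (tauInt_mul_le_bigGamma' P Q (by linarith) h2).2.trans h4
  · exact fun δ hδ => ⟨1 / (4 * δ), by positivity,
      eventually_atTop.1 (eventually_many_irreducible_of_le_three hn hF hδ)⟩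
  · intro η hη
    obtain ⟨H₀, h⟩ := eventually_atTop.1
      (eventually_one_le_log_log.and (eventually_many_irreducible_of_le_three hn hF hη))
    refine ⟨H₀, fun H hH P Q hPQ => ?_⟩
    obtain ⟨⟨h1, h2, -⟩, h3⟩ := h H hH
    exact nonempty_of_pos_le_ncard (by positivity) (h3 P Q hPQ)
  · exact eventually_atTop.1 (eventually_ncard_reduciblePrimes_le hn hF hε)
  · intro η hη
    obtain ⟨H₀, h⟩ := eventually_atTop.1 (eventually_bigGamma_le hη 1)
    exact ⟨H₀, fun H hH P Q hPQ _ => by simpa using h H hH n P Q hPQ⟩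
  · exact fun δ hδ hδ' => eventually_atTop.1 (eventually_many_irreducible_primes hn hF hε hδ hδ')
  · intro η hη
    -- The abundance of irreducible members is known only up to `deltaZero n ε`, so larger `η` are
    -- cut down to it.
    have hδ : 0 < min η (deltaZero n ε) := lt_min hη (deltaZero_pos n ε)
    obtain ⟨H₀, h⟩ := eventually_atTop.1 (eventually_one_le_log_log.and
      (eventually_many_irreducible_primes hn hF hε hδ (min_le_right _ _)))
    refine ⟨H₀, fun H hH P Q hPQ hroots => ?_⟩
    obtain ⟨⟨h1, h2, -⟩, h3⟩ := h H hH
    obtain ⟨l, hl, hle, hirr⟩ := nonempty_of_pos_le_ncard (by positivity) (h3 P Q hPQ hroots)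
    exact ⟨l, hl, hle.trans (Real.rpow_le_rpow_of_exponent_le h1 (min_le_left _ _)), hirr⟩
  · exact eventually_atTop.1 (eventually_ncard_reduciblePairs_le hn hε)
  · intro η hη
    obtain ⟨H₀, h⟩ := eventually_atTop.1 (eventually_bigGamma_le hη 1)
    exact ⟨H₀, fun H hH P Q hPQ _ => by simpa using h H hH n P Q hPQ⟩
  · exact fun δ hδ hδ' => eventually_atTop.1 (eventually_many_irreducible_pairs hn hε hδ hδ')
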